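/- Let $n\ge 1$, $\beta\in[\frac{n-1}{n},1)$ and $\alpha\in(0,1]$ with $\frac{\alpha}{n}=1-\beta$. For a function $f$ on $\mathbb R^n$ put $$[f]_{W^{\beta,n}}=\Big(\int_{\mathbb R^n}\int_{\mathbb R^n}\frac{|f(x)-f(y)|^n}{|x-y|^{n+\beta n}}\,dy\,dx\Big)^{1/n}\quad\text{if }\beta>0,\qquad [f]_{W^{0,n}}=\|f\|_{L^n}$$ (the case $\beta=0$ occurs only for $n=1$), let $W^{\beta,n}$ be the space of $f\in L^n$ with $[f]_{W^{\beta,n}}<\infty$, and let $[\varphi]_{C^{0,\alpha}}=\sup_{x\ne y}|\varphi(x)-\varphi(y)|/|x-y|^\alpha$. Then for every $\varphi:\mathbb R^n\to\mathbb R$ with $[\varphi]_{C^{0,\alpha}}<\infty$ and every $u\in W^{\beta,n}(\mathbb R^n;\mathbb R^n)$ the distributional Jacobian pairing $$\int_{\mathbb R^n}\det(Du)\,\varphi\,dx:=\lim_{k\to\infty}\int_{\mathbb R^n}\det(Du^{(k)})\,\varphi\,dx$$ is well defined: there are $u^{(k)}\in C_c^\infty(\mathbb R^n;\mathbb R^n)$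 with $u^{(k)}\to u$ in $W^{\beta,n}$, and for every such sequence the limit exists, with the same finite value. Moreover, there is a constant $C>0$, depending only on $n$, $\alpha$ and $\beta$, such that for all such $\varphi$ and all $u=(u_1,\dots,u_n)$, $v=(v_1,\dots,v_n)\in W^{\beta,n}(\mathbb R^n;\mathbb R^n)$, $$\Big|\int_{\mathbb R^n}\det(Du)\,\varphi\,dx\Big|\le C[\varphi]_{C^{0,\alpha}}\prod_{i=1}^n[u_i]_{W^{\beta,n}}$$ and $$\Big|\int_{\mathbb R^n}\big(\det(Du)-\det(Dv)\big)\varphi\,dx\Big|\le C[\varphi]_{C^{0,\alpha}}\sum_{j=1}^n\Big([u_j-v_j]_{W^{\beta,n}}\prod_{i=1}^{j-1}[v_i]_{W^{\beta,n}}\prod_{i=j+1}^{n}[u_i]_{W^{\beta,n}}\Big).$$ -/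

import Mathlib

open MeasureTheory Filter Topology
open scoped ENNReal NNReal ContDiff

namespace FracJacobian

/-- The Gagliardo (Sobolev–Slobodeckij) seminorm
`(∬ ‖f x - f y‖ ^ p / ‖x - y‖ ^ (n + β p) dy dx) ^ (1 / p)` on `ℝⁿ`, with values in `[0, ∞]`. -/
noncomputable def gagliardoSeminorm {n : ℕ} {F : Type*} [NormedAddCommGroup F]
    (β p : ℝ) (f : EuclideanSpace ℝ (Fin n) → F) : ℝ≥0∞ :=
  (∫⁻ x, ∫⁻ y, ‖f x - f y‖ₑ ^ p / ‖x - y‖ₑ ^ ((n : ℝ) + β * p)) ^ (1 / p)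

/-- The seminorm `[f]_{W^{β,p}(ℝⁿ)}`, `0 ≤ β < 1`: the Gagliardo seminorm if `0 < β < 1`, and, by
the usual convention, the `Lᵖ` norm if `β = 0`. -/
noncomputable def fracSeminorm {n : ℕ} {F : Type*} [NormedAddCommGroup F]
    (β p : ℝ) (f : EuclideanSpace ℝ (Fin n) → F) : ℝ≥0∞ :=
  open Classical in
  if β = 0 then eLpNorm f (ENNReal.ofReal p) volume else gagliardoSeminorm β p f

/-- `f ∈ W^{β,p}(ℝⁿ; F)`. -/
def MemFracSobolev {n : ℕ} {F : Type*} [NormedAddCommGroup F]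
    (β p : ℝ) (f : EuclideanSpace ℝ (Fin n) → F) : Prop :=
  MemLp f (ENNReal.ofReal p) volume ∧ fracSeminorm β p f < ⊤

/-- `w k → u` in the norm of `W^{β,p}(ℝⁿ; F)`, where each `w k` is smooth with compact support. -/
def IsSmoothApprox {n : ℕ} {F : Type*} [NormedAddCommGroup F] [NormedSpace ℝ F]
    (β p : ℝ) (u : EuclideanSpace ℝ (Fin n) → F)
    (w : ℕ → EuclideanSpace ℝ (Fin n) → F) : Prop :=
  (∀ k, ContDiff ℝ ∞ (w k) ∧ HasCompactSupport (w k)) ∧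
    Tendsto (fun k => eLpNorm (w k - u) (ENNReal.ofReal p) volume) atTop (𝓝 0) ∧
    Tendsto (fun k => fracSeminorm β p (w k - u)) atTop (𝓝 0)

/-- The classical integral `∫ det(Dw) φ dx` over `ℝⁿ`. -/
noncomputable def smoothJacobianIntegral {n : ℕ}
    (w : EuclideanSpace ℝ (Fin n) → EuclideanSpace ℝ (Fin n))
    (φ : EuclideanSpace ℝ (Fin n) → ℝ) : ℝ :=
  ∫ x, (fderiv ℝ w x).det * φ x

/-- The distributional Jacobian of `u ∈ W^{β,n}(ℝⁿ; ℝⁿ)`, defined by density: `∫ det(Du) φ dx` is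
meaningful with value `L` if `u` is a limit in `W^{β,n}` of smooth compactly supported maps, and
for every such approximating sequence `w` the integrals `∫ det(D(w k)) φ dx` converge to `L`. -/
def HasJacobianIntegral {n : ℕ} (β : ℝ)
    (u : EuclideanSpace ℝ (Fin n) → EuclideanSpace ℝ (Fin n))
    (φ : EuclideanSpace ℝ (Fin n) → ℝ) (L : ℝ) : Prop :=
  (∃ w, IsSmoothApprox β n u w) ∧
    ∀ w, IsSmoothApprox β n u w →
      Tendsto (fun k => smoothJacobianIntegral (w k) φ) atTop (𝓝 L)

end FracJacobian

/-! The estimate for smooth compactly supported maps comes from a decomposition into scales. Put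
P(r) = ∫ det(D u_r) φ_r, where the subscript denotes mollification at scale r. Then P(r) tends to ∫
det(Du) φ as r → 0. It tends to 0 as r → ∞ because P(r) = O(r^(α-n)) and α < n when β > 0. So the
pairing is a telescoping sum of differences P(r/2) - P(r) over dyadic scales.

One such difference is estimated by replacing first the test function and then the components one at
a time. In the latter terms the derivative on the small factor u_(r/2) - u_r is moved to φ_r by
parts, which is possible because the Jacobian is a null Lagrangian. With O_i(r) the integral of
|u_i(x-t) - u_i(x)|^n over all x and |t| ≤ r, the Lⁿ norm of D(u_i)_r is at most C r⁻² O_i(r)^(1/n),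
and that of (u_i)_r - u_i is smaller by a factor r. For φ the errors are [φ] r^α and the gradients
[φ] r^(α-1). The difference is therefore at most C [φ] r^α ∏ r⁻² O_i(r)^(1/n), and α = n(1-β) turns
this into C [φ] ∏ (r^(-n-βn) O_i(r))^(1/n). Hölder's inequality over the scales separates the
factors, and each sum of r^(-n-βn) O_i(r) is at most a multiple of [u_i]ⁿ: a fixed shift t meets
only the scales r ≥ |t|, whose weights form a geometric series of size |t|^(-n-βn). This is
`exists_mollPairing_step`, `exists_sum_osc_le` and `exists_jac_bound_of_pos`.

If β = 0, then n = α = 1 and the bound is integration by parts against a Lipschitz function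
(`exists_jac_bound_of_lipschitz`).

Multilinearity of the determinant gives the stability estimate for smooth maps. Together with
density (`exists_isSmoothApprox`) it makes the integrals along any approximating sequence Cauchy
with a common limit, and both inequalities pass to the limit. -/

namespace FracJacobian

/-! ### Jacobians of smooth tuples: null Lagrangian property and integration by parts. -/

section Jacobian

/-- Euclidean space of dimension `n`. -/
abbrev Euc (n : ℕ) := EuclideanSpace ℝ (Fin n)

variable {n : ℕ}

/-- The gradient of a function as a row vector of partial derivatives. -/
noncomputable def gradRow (f : Euc n → ℝ) (x : Euc n) : Fin n → ℝ :=
  fun k => fderiv ℝ f x (EuclideanSpace.single k 1)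

/-- The Jacobian determinant of a tuple of scalar functions. -/
noncomputable def jac (f : Fin n → Euc n → ℝ) (x : Euc n) : ℝ :=
  (Matrix.of fun i => gradRow (f i) x).det

/-- The determinant as a continuous multilinear function of the rows. -/
noncomputable def detRow (n : ℕ) :
    ContinuousMultilinearMap ℝ (fun _ : Fin n => Fin n → ℝ) ℝ where
  toMultilinearMap := (Matrix.detRowAlternating (n := Fin n) (R := ℝ)).toMultilinearMap
  cont := Continuous.matrix_det continuous_id

lemma jac_eq_detRow (f : Fin n → Euc n → ℝ) (x : Euc n) :
    jac f x = detRow n (fun i => gradRow (f i) x) := rfl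

lemma contDiff_gradRow {f : Euc n → ℝ} (hf : ContDiff ℝ ∞ f) : ContDiff ℝ ∞ (gradRow f) := by
  refine contDiff_pi.2 fun k => ?_
  exact (hf.fderiv_right (m := ∞) (by simp)).clm_apply contDiff_const

lemma contDiff_detRow {g : Fin n → Euc n → Fin n → ℝ} (hg : ∀ i, ContDiff ℝ ∞ (g i)) :
    ContDiff ℝ ∞ (fun x => detRow n (fun i => g i x)) :=
  (detRow n).contDiff.comp (contDiff_pi.2 hg)

lemma contDiff_jac {f : Fin n → Euc n → ℝ} (hf : ∀ i, ContDiff ℝ ∞ (f i)) :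
    ContDiff ℝ ∞ (jac f) :=
  contDiff_detRow fun i => contDiff_gradRow (hf i)

lemma gradRow_eq_zero {f : Euc n → ℝ} {x : Euc n} (hx : x ∉ tsupport f) : gradRow f x = 0 := by
  have : fderiv ℝ f x = 0 := by
    by_contra h
    exact hx (support_fderiv_subset ℝ h)
  ext k
  simp [gradRow, this]

lemma jac_eq_zero {f : Fin n → Euc n → ℝ} {x : Euc n} {j : Fin n} (hx : x ∉ tsupport (f j)) :
    jac f x = 0 := by
  rw [jac_eq_detRow]
  exact (detRow n).map_coord_zero j (gradRow_eq_zero hx)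

lemma hasCompactSupport_jac {f : Fin n → Euc n → ℝ} {j : Fin n} (hj : HasCompactSupport (f j)) :
    HasCompactSupport (jac f) :=
  HasCompactSupport.intro hj fun _ hx => jac_eq_zero hx

lemma gradRow_mul {f g : Euc n → ℝ} (hf : ContDiff ℝ ∞ f) (hg : ContDiff ℝ ∞ g) (x : Euc n) :
    gradRow (fun y => f y * g y) x = f x • gradRow g x + g x • gradRow f x := by
  have h1 := (hf.differentiable (by simp)) x
  have h2 := (hg.differentiable (by simp)) x
  ext k
  simp [gradRow, fderiv_fun_mul h1 h2]

lemma gradRow_sub {f g : Euc n → ℝ} (hf : ContDiff ℝ ∞ f) (hg : ContDiff ℝ ∞ g) (x : Euc n) :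
    gradRow (fun y => f y - g y) x = gradRow f x - gradRow g x := by
  have h1 := (hf.differentiable (by simp)) x
  have h2 := (hg.differentiable (by simp)) x
  ext k
  simp [gradRow, fderiv_fun_sub h1 h2]

lemma gradRow_update (f : Fin n → Euc n → ℝ) (j : Fin n) (h : Euc n → ℝ) (x : Euc n) :
    (fun i => gradRow (Function.update f j h i) x)
      = Function.update (fun i => gradRow (f i) x) j (gradRow h x) := by
  ext i k
  by_cases hi : i = j
  · subst hi; simp
  · simp [hi]

/-- An alternating bilinear expression contracted with a symmetric matrix vanishes. -/
lemma sum_symm_mul_alt {ι : Type*} [Fintype ι] (H D : ι → ι → ℝ) (hH : ∀ k l, H k l = H l k)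
    (hD : ∀ k l, D k l = - D l k) : ∑ k, ∑ l, H k l * D k l = 0 := by
  have h : ∑ k, ∑ l, H k l * D k l = - ∑ k, ∑ l, H k l * D k l := by
    conv_lhs => rw [Finset.sum_comm]
    rw [← Finset.sum_neg_distrib]
    refine Finset.sum_congr rfl fun k _ => ?_
    rw [← Finset.sum_neg_distrib]
    refine Finset.sum_congr rfl fun l _ => ?_
    rw [hH, hD]; ring
  linarith

lemma fderiv_gradRow_symm {f : Euc n → ℝ} (hf : ContDiff ℝ ∞ f) (x : Euc n) (k l : Fin n) :
    fderiv ℝ (gradRow f) x (EuclideanSpace.single k 1) l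
      = fderiv ℝ (gradRow f) x (EuclideanSpace.single l 1) k := by
  have hd : DifferentiableAt ℝ (fderiv ℝ f) x :=
    ((hf.fderiv_right (m := ∞) (by simp)).differentiable (by simp)) x
  have key : ∀ v m, fderiv ℝ (gradRow f) x v m
      = fderiv ℝ (fderiv ℝ f) x v (EuclideanSpace.single m 1) := by
    intro v m
    have h1 : HasFDerivAt (gradRow f) (ContinuousLinearMap.pi fun m =>
        (fderiv ℝ (fderiv ℝ f) x).flip (EuclideanSpace.single m 1)) x := by
      refine hasFDerivAt_pi.2 fun m => ?_
      have := hd.hasFDerivAt.clm_apply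
        (hasFDerivAt_const (EuclideanSpace.single m (1 : ℝ) : Euc n) x)
      simpa [gradRow] using! this
    rw [h1.fderiv]; simp
  rw [key, key]
  exact (hf.contDiffAt.isSymmSndFDerivAt (by simp; exact WithTop.coe_le_coe.2 le_top)) _ _

/-- The rows of the cofactor matrix of a Jacobian matrix are divergence free. -/
lemma sum_fderiv_cofactor_eq_zero {g : Fin n → Euc n → ℝ} (hg : ∀ i, ContDiff ℝ ∞ (g i))
    (j : Fin n) (x : Euc n) :
    ∑ k, fderiv ℝ (fun y => detRow n (Function.update (fun i => gradRow (g i) y) j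
      (Pi.single k 1))) x (EuclideanSpace.single k 1) = 0 := by
  set M : Fin n → Fin n → ℝ := fun i => gradRow (g i) x with hM
  have h1 : ∀ k, fderiv ℝ (fun y => detRow n (Function.update (fun i => gradRow (g i) y) j
      (Pi.single k 1))) x (EuclideanSpace.single k 1)
      = ∑ i ∈ Finset.univ.erase j, ∑ l, fderiv ℝ (gradRow (g i)) x (EuclideanSpace.single k 1) l *
          detRow n (Function.update (Function.update M j (Pi.single k 1)) i (Pi.single l 1)) := by
    intro k
    set G : Fin n → Euc n → Fin n → ℝ := fun i y =>
      Function.update (fun i => gradRow (g i) y) j (Pi.single k 1) i with hG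
    have hd : ∀ i, HasFDerivAt (G i)
        (if i = j then 0 else fderiv ℝ (gradRow (g i)) x) x := by
      intro i
      by_cases hi : i = j
      · subst hi
        simpa [hG] using hasFDerivAt_const (𝕜 := ℝ) (Pi.single k (1 : ℝ) : Fin n → ℝ) x
      · simp only [hG, hi, if_false, Function.update_of_ne, ne_eq, not_false_eq_true]
        exact ((contDiff_gradRow (hg i)).differentiable (by simp) x).hasFDerivAt
    have h2 := (HasFDerivAt.multilinear_comp (f := detRow n) hd).fderiv
    have h3 : (fun y => detRow n (Function.update (fun i => gradRow (g i) y) j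
      (Pi.single k 1))) = fun y => detRow n (fun i => G i y) := rfl
    rw [h3, h2, sum_apply]
    -- Row `j` is constant, so its term in the product rule vanishes; the derivative of every other
    -- row is expanded in the standard basis.
    rw [← Finset.add_sum_erase _ _ (Finset.mem_univ j)]
    simp only [if_true, ContinuousLinearMap.comp_zero, zero_apply, zero_add]
    refine Finset.sum_congr rfl fun i hi => ?_
    have hij : i ≠ j := (Finset.mem_erase.1 hi).1
    have hGx : (fun j => G j x) = Function.update M j (Pi.single k 1) := rfl
    simp only [if_neg hij, ContinuousLinearMap.comp_apply, hGx]
    set w := fderiv ℝ (gradRow (g i)) x (EuclideanSpace.single k 1) with hw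
    change detRow n (Function.update (Function.update M j (Pi.single k 1)) i w) = _
    conv_lhs => rw [pi_eq_sum_univ' w]
    erw [(detRow n).toMultilinearMap.map_update_sum]
    refine Finset.sum_congr rfl fun l _ => ?_
    exact (detRow n).toMultilinearMap.map_update_smul _ _ _ _
  simp_rw [h1]
  rw [Finset.sum_comm]
  refine Finset.sum_eq_zero fun i hi => ?_
  have hij : i ≠ j := (Finset.mem_erase.1 hi).1
  -- For fixed `i ≠ j` the Hessian of `g i` is symmetric in `k, l`, while exchanging `k` and `l`
  -- swaps rows `i` and `j` of the determinant.
  refine sum_symm_mul_alt _ _ (fun k l => fderiv_gradRow_symm (hg i) x k l) fun k l => ?_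
  have := (Matrix.detRowAlternating (n := Fin n) (R := ℝ)).map_swap
    (Function.update (Function.update M j (Pi.single l 1)) i (Pi.single k 1)) hij
  refine Eq.trans (congrArg (Matrix.detRowAlternating (n := Fin n) (R := ℝ)) ?_) this
  refine funext fun a => ?_
  by_cases ha : a = i
  · subst ha; simp [hij.symm]
  · by_cases hb : a = j
    · subst hb; simp [hij.symm]
    · simp [Equiv.swap_apply_of_ne_of_ne, ha, hb]

/-- The Jacobian determinant is a null Lagrangian. -/
lemma integral_jac_eq_zero {g : Fin n → Euc n → ℝ} (hg : ∀ i, ContDiff ℝ ∞ (g i))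
    (j : Fin n) (hj : HasCompactSupport (g j)) : ∫ x, jac g x = 0 := by
  set c : Fin n → Euc n → ℝ := fun k y =>
    detRow n (Function.update (fun i => gradRow (g i) y) j (Pi.single k 1)) with hc
  have hcs : ∀ k, ContDiff ℝ ∞ (c k) := by
    intro k
    refine contDiff_detRow (g := fun i y =>
      Function.update (fun i => gradRow (g i) y) j (Pi.single k 1) i) fun i => ?_
    by_cases hi : i = j
    · subst hi; simpa using contDiff_const
    · simpa [hi] using contDiff_gradRow (hg i)
  -- Laplace expansion along row `j`: the `c k` are the cofactors of that row, and their divergence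
  -- vanishes.
  have h1 : ∀ x, jac g x = ∑ k, c k x * fderiv ℝ (g j) x (EuclideanSpace.single k 1) := by
    intro x
    unfold jac
    rw [Matrix.det_eq_sum_mul_adjugate_row _ j]
    refine Finset.sum_congr rfl fun k _ => ?_
    rw [Matrix.adjugate_apply, mul_comm]
    rfl
  have hdc : ∀ k, Continuous fun x => fderiv ℝ (c k) x (EuclideanSpace.single k 1) := fun k =>
    ((hcs k).continuous_fderiv (by simp)).clm_apply continuous_const
  have hdg : ∀ k, Continuous fun x => fderiv ℝ (g j) x (EuclideanSpace.single k 1) := fun k =>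
    ((hg j).continuous_fderiv (by simp)).clm_apply continuous_const
  have i1 : ∀ k, Integrable fun x => c k x * fderiv ℝ (g j) x (EuclideanSpace.single k 1) :=
    fun k => ((hcs k).continuous.mul (hdg k)).integrable_of_hasCompactSupport
      ((hj.fderiv_apply ℝ _).mul_left)
  have i2 : ∀ k, Integrable fun x => fderiv ℝ (c k) x (EuclideanSpace.single k 1) * g j x :=
    fun k => ((hdc k).mul (hg j).continuous).integrable_of_hasCompactSupport hj.mul_left
  simp_rw [h1]
  rw [integral_finsetSum _ fun k _ => i1 k]
  have h2 : ∀ k, ∫ x, c k x * fderiv ℝ (g j) x (EuclideanSpace.single k 1)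
      = - ∫ x, fderiv ℝ (c k) x (EuclideanSpace.single k 1) * g j x := by
    intro k
    refine integral_mul_fderiv_eq_neg_fderiv_mul_of_integrable (i2 k) (i1 k) ?_ ?_ ?_
    · exact ((hcs k).continuous.mul (hg j).continuous).integrable_of_hasCompactSupport hj.mul_left
    · exact fun x _ => (hcs k).differentiable (by simp) x
    · exact fun x _ => (hg j).differentiable (by simp) x
  simp_rw [h2]
  rw [Finset.sum_neg_distrib, ← integral_finsetSum _ fun k _ => i2 k, neg_eq_zero]
  simp_rw [← Finset.sum_mul, hc, sum_fderiv_cofactor_eq_zero hg j, zero_mul, integral_zero]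

/-- Integration by parts for the Jacobian pairing. -/
lemma integral_mul_jac_eq_neg {f : Fin n → Euc n → ℝ} (hf : ∀ i, ContDiff ℝ ∞ (f i))
    (j : Fin n) (hj : HasCompactSupport (f j)) {f₀ : Euc n → ℝ} (h₀ : ContDiff ℝ ∞ f₀) :
    ∫ x, jac f x * f₀ x = - ∫ x, f j x * jac (Function.update f j f₀) x := by
  have hu : ∀ (h : Euc n → ℝ), ContDiff ℝ ∞ h → ∀ i, ContDiff ℝ ∞ (Function.update f j h i) := by
    intro h hh i
    by_cases hi : i = j
    · subst hi; simpa using hh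
    · simpa [hi] using hf i
  -- The null Lagrangian property is applied with `f₀ * f j` in slot `j`; the Leibniz rule in that
  -- row yields the two sides of the identity.
  have h1 := integral_jac_eq_zero (hu (fun y => f₀ y * f j y) (h₀.mul (hf j))) j
    (by simpa using! hj.mul_left (f := f₀))
  have h2 : ∀ x, jac (Function.update f j fun y => f₀ y * f j y) x
      = jac f x * f₀ x + f j x * jac (Function.update f j f₀) x := by
    intro x
    rw [jac_eq_detRow, jac_eq_detRow, jac_eq_detRow, gradRow_update, gradRow_update,
      gradRow_mul h₀ (hf j), ContinuousMultilinearMap.map_update_add,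
      ContinuousMultilinearMap.map_update_smul, ContinuousMultilinearMap.map_update_smul,
      Function.update_eq_self j (fun i => gradRow (f i) x), smul_eq_mul, smul_eq_mul]
    ring
  simp_rw [h2] at h1
  rw [integral_add] at h1
  · linarith
  · exact ((contDiff_jac hf).continuous.mul h₀.continuous).integrable_of_hasCompactSupport
      (hasCompactSupport_jac hj).mul_right
  · exact ((hf j).continuous.mul (contDiff_jac (hu f₀ h₀)).continuous).integrable_of_hasCompactSupport
      hj.mul_right

lemma abs_gradRow_le (f : Euc n → ℝ) (x : Euc n) (k : Fin n) :
    |gradRow f x k| ≤ ‖fderiv ℝ f x‖ := by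
  simpa [gradRow] using (fderiv ℝ f x).le_opNorm (EuclideanSpace.single k 1)

lemma abs_jac_le (f : Fin n → Euc n → ℝ) (x : Euc n) :
    |jac f x| ≤ n.factorial * ∏ i, ‖fderiv ℝ (f i) x‖ := by
  unfold jac
  rw [Matrix.det_apply']
  refine (Finset.abs_sum_le_sum_abs _ _).trans ?_
  have : ∀ σ ∈ (Finset.univ : Finset (Equiv.Perm (Fin n))),
      |((Equiv.Perm.sign σ : ℤ) : ℝ) * ∏ i, gradRow (f (σ i)) x i|
        ≤ ∏ i, ‖fderiv ℝ (f i) x‖ := by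
    intro σ _
    have hs : |((Equiv.Perm.sign σ : ℤ) : ℝ)| = 1 := by
      rcases Int.units_eq_one_or (Equiv.Perm.sign σ) with h | h <;> simp [h]
    rw [abs_mul, hs, one_mul, Finset.abs_prod,
      ← Equiv.prod_comp σ fun i => ‖fderiv ℝ (f i) x‖]
    exact Finset.prod_le_prod (fun _ _ => abs_nonneg _) fun i _ => abs_gradRow_le _ _ _
  refine (Finset.sum_le_sum this).trans ?_
  simp [Finset.card_univ, Fintype.card_perm]

lemma enorm_jac_le (f : Fin n → Euc n → ℝ) (x : Euc n) :
    ‖jac f x‖ₑ ≤ n.factorial * ∏ i, ‖fderiv ℝ (f i) x‖ₑ := by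
  have h := ENNReal.ofReal_le_ofReal (abs_jac_le f x)
  rw [← Real.enorm_eq_ofReal_abs, ENNReal.ofReal_mul (by positivity),
    ENNReal.ofReal_prod_of_nonneg (fun _ _ => norm_nonneg _)] at h
  simpa using h

end Jacobian

/-! ### Hölder estimates for the pairing and comparison of two tuples. -/

section HolderBounds

variable {n : ℕ}

/-- The tuple agreeing with `g` before `j`, with `f` after `j`, and equal to `f j - g j` at `j`. -/
noncomputable def hybrid (f g : Fin n → Euc n → ℝ) (j : Fin n) : Fin n → Euc n → ℝ :=
  fun i => if i < j then g i else if i = j then fun x => f j x - g j x else f i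

lemma hybrid_self (f g : Fin n → Euc n → ℝ) (j : Fin n) :
    hybrid f g j j = fun x => f j x - g j x := by simp [hybrid]

lemma hybrid_of_lt (f g : Fin n → Euc n → ℝ) {i j : Fin n} (h : i < j) :
    hybrid f g j i = g i := by simp [hybrid, h]

lemma hybrid_of_gt (f g : Fin n → Euc n → ℝ) {i j : Fin n} (h : j < i) :
    hybrid f g j i = f i := by simp [hybrid, h.not_gt, h.ne']

lemma contDiff_hybrid {f g : Fin n → Euc n → ℝ} (hf : ∀ i, ContDiff ℝ ∞ (f i))
    (hg : ∀ i, ContDiff ℝ ∞ (g i)) (j i : Fin n) : ContDiff ℝ ∞ (hybrid f g j i) := by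
  unfold hybrid
  split_ifs
  exacts [hg i, (hf j).sub (hg j), hf i]

lemma hasCompactSupport_hybrid {f g : Fin n → Euc n → ℝ} (hf : ∀ i, HasCompactSupport (f i))
    (hg : ∀ i, HasCompactSupport (g i)) (j i : Fin n) : HasCompactSupport (hybrid f g j i) := by
  unfold hybrid
  split_ifs
  exacts [hg i, (hf j).sub (hg j), hf i]

/-- Multilinearity: the rows are exchanged one at a time, and the telescoping terms are the
determinants of the hybrid tuples. -/
lemma jac_sub_jac {f g : Fin n → Euc n → ℝ} (hf : ∀ i, ContDiff ℝ ∞ (f i))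
    (hg : ∀ i, ContDiff ℝ ∞ (g i)) (x : Euc n) :
    jac f x - jac g x = ∑ j, jac (hybrid f g j) x := by
  set a : Fin n → Fin n → ℝ := fun i => gradRow (g i) x
  set b : Fin n → Fin n → ℝ := fun i => gradRow (f i) x
  have h := (detRow n).toMultilinearMap.map_piecewise_sub_map_piecewise a b b Finset.univ
  simp only [Finset.piecewise_univ, Finset.mem_univ, if_true] at h
  have h2 : jac f x - jac g x = -((detRow n).toMultilinearMap a - (detRow n).toMultilinearMap b) := by
    rw [neg_sub]; rfl
  rw [h2, h, ← Finset.sum_neg_distrib]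
  refine Finset.sum_congr rfl fun j _ => ?_
  set H : Fin n → Fin n → ℝ := fun i => if i < j then a i else b i
  have e1 : (fun i => if i < j then a i else if i = j then a i - b i else b i)
      = Function.update H j (-(b j - a j)) := by
    funext i
    by_cases hi : i = j
    · subst hi; simp
    · simp [hi, H]
  have e2 : (fun i => gradRow (hybrid f g j i) x) = Function.update H j (b j - a j) := by
    funext i
    rcases lt_trichotomy i j with hi | hi | hi
    · simp [hybrid_of_lt f g hi, hi.ne, H, hi, a]
    · subst hi
      simp [hybrid_self, gradRow_sub (hf i) (hg i), a, b]
    · simp [hybrid_of_gt f g hi, hi.ne', H, hi.not_gt, b]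
  rw [e1, MultilinearMap.map_update_neg, neg_neg, jac_eq_detRow, e2]
  rfl

lemma eLpNorm_natCast_eq {X F : Type*} [MeasurableSpace X] [NormedAddCommGroup F] {μ : Measure X}
    (hn : 1 ≤ n) (f : X → F) :
    eLpNorm f n μ = (∫⁻ x, ‖f x‖ₑ ^ (n : ℝ) ∂μ) ^ (1 / (n : ℝ)) := by
  rw [eLpNorm_eq_lintegral_rpow_enorm_toReal (by exact_mod_cast (by omega : n ≠ 0)) (by simp)]
  simp

lemma lintegral_prod_le {X : Type*} [MeasurableSpace X] {μ : Measure X} (hn : 1 ≤ n)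
    {g : Fin n → X → ℝ≥0∞} (hg : ∀ i, AEMeasurable (g i) μ) :
    ∫⁻ x, ∏ i, g i x ∂μ ≤ ∏ i, (∫⁻ x, g i x ^ (n : ℝ) ∂μ) ^ (1 / (n : ℝ)) := by
  have hn0 : (n : ℝ) ≠ 0 := by positivity
  have h := ENNReal.lintegral_prod_norm_pow_le (μ := μ) Finset.univ
    (f := fun i x => g i x ^ (n : ℝ)) (fun i _ => (hg i).pow_const _)
    (p := fun _ => 1 / (n : ℝ)) (by simp [hn0]) (fun i _ => by positivity)
  simpa only [← ENNReal.rpow_mul, mul_one_div_cancel hn0, ENNReal.rpow_one] using h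

/-- Used when the test function itself is small: only its supremum enters, and Hölder distributes
the gradients with `n` equal exponents. -/
lemma enorm_integral_jac_mul_le (hn : 1 ≤ n) {f : Fin n → Euc n → ℝ}
    (hf : ∀ i, ContDiff ℝ ∞ (f i)) {f₀ : Euc n → ℝ} {m : ℝ≥0∞} (hm : ∀ x, ‖f₀ x‖ₑ ≤ m) :
    ‖∫ x, jac f x * f₀ x‖ₑ ≤
      n.factorial * m * ∏ i, eLpNorm (fderiv ℝ (f i)) n volume := by
  have hmeas : ∀ i, Measurable fun x => ‖fderiv ℝ (f i) x‖ₑ := fun i =>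
    ((hf i).continuous_fderiv (by simp)).enorm.measurable
  calc ‖∫ x, jac f x * f₀ x‖ₑ ≤ ∫⁻ x, ‖jac f x * f₀ x‖ₑ := enorm_integral_le_lintegral_enorm _
    _ ≤ ∫⁻ x, (n.factorial * m) * ∏ i, ‖fderiv ℝ (f i) x‖ₑ := by
        refine lintegral_mono fun x => ?_
        rw [enorm_mul, mul_right_comm]
        gcongr
        exacts [enorm_jac_le f x, hm x]
    _ = (n.factorial * m) * ∫⁻ x, ∏ i, ‖fderiv ℝ (f i) x‖ₑ :=
        lintegral_const_mul _ (Finset.measurable_fun_prod _ fun i _ => hmeas i)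
    _ ≤ _ := by
        gcongr
        refine (lintegral_prod_le hn fun i => (hmeas i).aemeasurable).trans_eq ?_
        simp_rw [eLpNorm_natCast_eq hn]

/-- Used when one component is small in `Lⁿ` but its gradient is not: integration by parts in slot
`j` trades that gradient for the gradient of `f₀`. -/
lemma enorm_integral_jac_mul_le_of_fderiv (hn : 1 ≤ n) {f : Fin n → Euc n → ℝ}
    (hf : ∀ i, ContDiff ℝ ∞ (f i)) (j : Fin n) (hj : HasCompactSupport (f j))
    {f₀ : Euc n → ℝ} (h₀ : ContDiff ℝ ∞ f₀) {L : ℝ≥0∞} (hL : ∀ x, ‖fderiv ℝ f₀ x‖ₑ ≤ L) :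
    ‖∫ x, jac f x * f₀ x‖ₑ ≤ n.factorial * L * (eLpNorm (f j) n volume *
      ∏ i ∈ Finset.univ.erase j, eLpNorm (fderiv ℝ (f i)) n volume) := by
  have hmeas : ∀ i, Measurable fun x => ‖fderiv ℝ (f i) x‖ₑ := fun i =>
    ((hf i).continuous_fderiv (by simp)).enorm.measurable
  set g : Fin n → Euc n → ℝ≥0∞ := fun i x => if i = j then ‖f j x‖ₑ else ‖fderiv ℝ (f i) x‖ₑ
    with hg
  have hgm : ∀ i, Measurable (g i) := by
    intro i
    by_cases hi : i = j
    · simpa [hg, hi] using (hf j).continuous.enorm.measurable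
    · simpa [hg, hi] using hmeas i
  have hprod : ∀ x, ∏ i, g i x
      = ‖f j x‖ₑ * ∏ i ∈ Finset.univ.erase j, ‖fderiv ℝ (f i) x‖ₑ := by
    intro x
    rw [← Finset.mul_prod_erase _ _ (Finset.mem_univ j)]
    congr 1
    · simp [hg]
    · exact Finset.prod_congr rfl fun i hi => by simp [hg, (Finset.mem_erase.1 hi).1]
  rw [integral_mul_jac_eq_neg hf j hj h₀, enorm_neg]
  calc ‖∫ x, f j x * jac (Function.update f j f₀) x‖ₑ
      ≤ ∫⁻ x, ‖f j x * jac (Function.update f j f₀) x‖ₑ := enorm_integral_le_lintegral_enorm _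
    _ ≤ ∫⁻ x, (n.factorial * L) * ∏ i, g i x := by
        refine lintegral_mono fun x => ?_
        have h1 := enorm_jac_le (Function.update f j f₀) x
        rw [← Finset.mul_prod_erase _ _ (Finset.mem_univ j), Function.update_self] at h1
        have h2 : ∏ i ∈ Finset.univ.erase j, ‖fderiv ℝ (Function.update f j f₀ i) x‖ₑ
            = ∏ i ∈ Finset.univ.erase j, ‖fderiv ℝ (f i) x‖ₑ :=
          Finset.prod_congr rfl fun i hi => by
            rw [Function.update_of_ne (Finset.mem_erase.1 hi).1]
        rw [h2] at h1
        simp only [hprod, enorm_mul]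
        calc ‖f j x‖ₑ * ‖jac (Function.update f j f₀) x‖ₑ
            ≤ ‖f j x‖ₑ * (n.factorial * (L * ∏ i ∈ Finset.univ.erase j, ‖fderiv ℝ (f i) x‖ₑ)) := by
              gcongr
              refine h1.trans ?_
              gcongr
              exact hL x
          _ = _ := by ring
    _ = (n.factorial * L) * ∫⁻ x, ∏ i, g i x :=
        lintegral_const_mul _ (Finset.measurable_fun_prod _ fun i _ => hgm i)
    _ ≤ _ := by
        gcongr
        refine (lintegral_prod_le hn fun i => (hgm i).aemeasurable).trans_eq ?_
        rw [← Finset.mul_prod_erase _ _ (Finset.mem_univ j)]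
        simp_rw [eLpNorm_natCast_eq hn]
        congr 1
        · simp [hg]
        · exact Finset.prod_congr rfl fun i hi => by simp [hg, (Finset.mem_erase.1 hi).1]

lemma integrable_jac_mul (hn : 1 ≤ n) {f : Fin n → Euc n → ℝ}
    (hf : ∀ i, ContDiff ℝ ∞ (f i)) (hfc : ∀ i, HasCompactSupport (f i))
    {f₀ : Euc n → ℝ} (h₀ : Continuous f₀) : Integrable fun x => jac f x * f₀ x :=
  ((contDiff_jac hf).continuous.mul h₀).integrable_of_hasCompactSupport
    (hasCompactSupport_jac (hfc ⟨0, hn⟩)).mul_right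

/-- Stability of the Jacobian pairing at a fixed scale `r`. -/
lemma enorm_integral_jac_mul_sub_le (hn : 1 ≤ n) {f g : Fin n → Euc n → ℝ}
    (hf : ∀ i, ContDiff ℝ ∞ (f i)) (hfc : ∀ i, HasCompactSupport (f i))
    (hg : ∀ i, ContDiff ℝ ∞ (g i)) (hgc : ∀ i, HasCompactSupport (g i))
    {f₀ g₀ : Euc n → ℝ} (hf₀ : Continuous f₀) (hg₀ : ContDiff ℝ ∞ g₀) {m L r : ℝ≥0∞}
    (hm : ∀ x, ‖f₀ x - g₀ x‖ₑ ≤ m) (hL : ∀ x, ‖fderiv ℝ g₀ x‖ₑ ≤ L) {B : Fin n → ℝ≥0∞}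
    (hfB : ∀ i, eLpNorm (fderiv ℝ (f i)) n volume ≤ B i)
    (hgB : ∀ i, eLpNorm (fderiv ℝ (g i)) n volume ≤ B i)
    (hfg : ∀ i, eLpNorm (fun x => f i x - g i x) n volume ≤ r * B i) :
    ‖(∫ x, jac f x * f₀ x) - ∫ x, jac g x * g₀ x‖ₑ
      ≤ n.factorial * (m + n * (L * r)) * ∏ i, B i := by
  -- The test function is exchanged first, at the cost `m`. Each hybrid term then carries the small
  -- factor `f j - g j` in the slot where the integration by parts takes place, which costs `L * r`.
  have e : (∫ x, jac f x * f₀ x) - ∫ x, jac g x * g₀ x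
      = (∫ x, jac f x * (f₀ x - g₀ x)) + ∑ j, ∫ x, jac (hybrid f g j) x * g₀ x := by
    rw [← integral_finsetSum _ fun j _ => integrable_jac_mul hn (contDiff_hybrid hf hg j)
      (hasCompactSupport_hybrid hfc hgc j) hg₀.continuous]
    simp_rw [← Finset.sum_mul, ← jac_sub_jac hf hg, sub_mul, mul_sub]
    have i1 := integrable_jac_mul hn hf hfc hf₀
    have i2 := integrable_jac_mul hn hf hfc hg₀.continuous
    have i3 := integrable_jac_mul hn hg hgc hg₀.continuous
    rw [integral_sub i1 i2, integral_sub i2 i3]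
    ring
  rw [e]
  refine (enorm_add_le _ _).trans ?_
  have h1 : ‖∫ x, jac f x * (f₀ x - g₀ x)‖ₑ ≤ n.factorial * m * ∏ i, B i := by
    refine (enorm_integral_jac_mul_le hn hf hm).trans ?_
    gcongr with i
    exact hfB i
  have h2 : ‖∑ j, ∫ x, jac (hybrid f g j) x * g₀ x‖ₑ
      ≤ ∑ j : Fin n, n.factorial * L * (r * ∏ i, B i) := by
    refine (enorm_sum_le _ _).trans (Finset.sum_le_sum fun j _ => ?_)
    refine (enorm_integral_jac_mul_le_of_fderiv hn (contDiff_hybrid hf hg j) j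
      (hasCompactSupport_hybrid hfc hgc j j) hg₀ hL).trans ?_
    refine mul_le_mul_right ?_ _
    rw [← Finset.mul_prod_erase _ _ (Finset.mem_univ j), ← mul_assoc, hybrid_self]
    gcongr with i hi
    · exact hfg j
    · rcases lt_or_gt_of_ne (Finset.mem_erase.1 hi).1 with h | h
      · rw [hybrid_of_lt f g h]; exact hgB i
      · rw [hybrid_of_gt f g h]; exact hfB i
  refine (add_le_add h1 h2).trans_eq ?_
  simp only [Finset.sum_const, Finset.card_univ, Fintype.card_fin, nsmul_eq_mul]
  ring

end HolderBounds

/-! ### Mollification errors and gradients in terms of mean oscillation. -/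

section Mollification

variable {n : ℕ}

section Oscillation

variable {F : Type*} [NormedAddCommGroup F]

/-- Mean oscillation of `u` around `x` at scale `r`, normalised by `r ^ n`. -/
noncomputable def meanOsc (r : ℝ) (u : Euc n → F) (x : Euc n) : ℝ≥0∞ :=
  (ENNReal.ofReal r ^ n)⁻¹ * ∫⁻ t in Metric.closedBall 0 r, ‖u (x - t) - u x‖ₑ

lemma lintegral_mul_le_meanOsc {r : ℝ} (u : Euc n → F) (x : Euc n)
    {K : Euc n → ℝ≥0∞} (hK : ∀ t ∉ Metric.closedBall 0 r, K t = 0) {M : ℝ≥0∞}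
    (hM : ∀ t, K t ≤ M * (ENNReal.ofReal r ^ n)⁻¹) (hMt : M * (ENNReal.ofReal r ^ n)⁻¹ ≠ ⊤) :
    ∫⁻ t, K t * ‖u (x - t) - u x‖ₑ ≤ M * meanOsc r u x := by
  rw [meanOsc, ← mul_assoc, ← lintegral_const_mul' _ _ hMt, ← lintegral_indicator
    Metric.isClosed_closedBall.measurableSet]
  refine lintegral_mono fun t => ?_
  by_cases ht : t ∈ Metric.closedBall (0 : Euc n) r
  · simp only [ht, Set.indicator_of_mem]
    gcongr
    exact hM t
  · simp [hK t ht]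

lemma ofReal_pow_inv_ne_top {r : ℝ} (hr : 0 < r) (n : ℕ) : (ENNReal.ofReal r ^ n)⁻¹ ≠ ⊤ := by
  simp [hr]

/-- The `p`-th power of the `Lᵖ` modulus of continuity. -/
noncomputable def shiftEnergy (p : ℝ) (u : Euc n → F) (t : Euc n) : ℝ≥0∞ :=
  ∫⁻ x, ‖u (x - t) - u x‖ₑ ^ p

/-- The energy of `u` over pairs of points at distance at most `r`. -/
noncomputable def osc (p r : ℝ) (u : Euc n → F) : ℝ≥0∞ :=
  ∫⁻ t in Metric.closedBall 0 r, shiftEnergy p u t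

lemma measurable_shift_sub [MeasurableSpace F] [BorelSpace F] [SecondCountableTopology F]
    {u : Euc n → F} (hu : Measurable u) :
    Measurable fun z : Euc n × Euc n => ‖u (z.1 - z.2) - u z.1‖ₑ :=
  ((hu.comp (measurable_fst.sub measurable_snd)).sub (hu.comp measurable_fst)).enorm

/-- Jensen's inequality for a finite measure that need not be normalised. -/
lemma rpow_lintegral_le {X : Type*} [MeasurableSpace X] (μ : Measure X) {p : ℝ} (hp : 1 ≤ p)
    {f : X → ℝ≥0∞} (hf : AEMeasurable f μ) :
    (∫⁻ x, f x ∂μ) ^ p ≤ μ Set.univ ^ (p - 1) * ∫⁻ x, f x ^ p ∂μ := by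
  have h := eLpNorm'_le_eLpNorm'_mul_rpow_measure_univ (μ := μ) (p := 1) (q := p) one_pos hp
    hf.aestronglyMeasurable
  simp only [eLpNorm', enorm_eq_self, ENNReal.rpow_one, div_one] at h
  have hp0 : p ≠ 0 := by positivity
  refine (ENNReal.rpow_le_rpow h (by positivity : 0 ≤ p)).trans_eq ?_
  rw [ENNReal.mul_rpow_of_nonneg _ _ (by positivity), ← ENNReal.rpow_mul, ← ENNReal.rpow_mul,
    one_div_mul_cancel hp0, ENNReal.rpow_one, mul_comm]
  congr 2
  field_simp

lemma volume_closedBall_euc (n : ℕ) {r : ℝ} (hr : 0 ≤ r) :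
    volume (Metric.closedBall (0 : Euc n) r)
      = ENNReal.ofReal r ^ n * volume (Metric.ball (0 : Euc n) 1) := by
  rw [Measure.addHaar_closedBall _ _ hr, finrank_euclideanSpace, Fintype.card_fin,
    ENNReal.ofReal_pow hr]

lemma osc_eq [MeasurableSpace F] [BorelSpace F] [SecondCountableTopology F]
    (p r : ℝ) {u : Euc n → F} (hu : Measurable u) :
    osc p r u = ∫⁻ x, ∫⁻ t in Metric.closedBall 0 r, ‖u (x - t) - u x‖ₑ ^ p := by
  unfold osc shiftEnergy
  exact lintegral_lintegral_swap
    (((measurable_shift_sub hu).comp measurable_swap).pow_const p).aemeasurable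

/-- Bookkeeping of powers: `R^(-n²)` from the normalisation meets `R^(n(n-1))` from Jensen, and the
`n`-th root of `R^(-n)` leaves `R⁻¹`. Writing `n = m + 1` turns the real exponents into natural
ones. -/
lemma rpow_meanOsc_const (hn : 1 ≤ n) {R : ℝ≥0∞} (hR : R ≠ 0) (hR' : R ≠ ⊤) (c O : ℝ≥0∞) :
    ((R ^ n)⁻¹ ^ (n : ℝ) * ((R ^ n * c) ^ ((n : ℝ) - 1) * O)) ^ (1 / (n : ℝ))
      = c ^ (((n : ℝ) - 1) / n) * (R⁻¹ * O ^ (1 / (n : ℝ))) := by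
  obtain ⟨m, rfl⟩ : ∃ m, n = m + 1 := ⟨n - 1, by omega⟩
  have hm : ((m + 1 : ℕ) : ℝ) ≠ 0 := by positivity
  have hm' : (((m + 1 : ℕ) : ℝ) - 1) = (m : ℝ) := by push_cast; ring
  have hQ : R ^ (m + 1) ≠ 0 := pow_ne_zero _ hR
  have hQ' : R ^ (m + 1) ≠ ⊤ := ENNReal.pow_ne_top hR'
  have e : (R ^ (m + 1))⁻¹ ^ (m + 1) * ((R ^ (m + 1) * c) ^ m * O)
      = c ^ m * (R⁻¹ ^ (m + 1) * O) := by
    have hi : R⁻¹ ^ (m + 1) = (R ^ (m + 1))⁻¹ := ENNReal.inv_pow.symm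
    have h1 := ENNReal.inv_mul_cancel hQ hQ'
    rw [hi]
    generalize (R ^ (m + 1))⁻¹ = P at h1
    generalize R ^ (m + 1) = Q at h1
    calc _ = (P * Q) ^ m * (c ^ m * (P * O)) := by ring
      _ = _ := by rw [h1, one_pow, one_mul]
  rw [hm', ENNReal.rpow_natCast, ENNReal.rpow_natCast, e,
    ENNReal.mul_rpow_of_nonneg _ _ (by positivity), ENNReal.mul_rpow_of_nonneg _ _ (by positivity),
    ← ENNReal.rpow_natCast, ← ENNReal.rpow_natCast, ← ENNReal.rpow_mul, ← ENNReal.rpow_mul,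
    mul_one_div_cancel hm, ENNReal.rpow_one, mul_one_div]

/-- Jensen in the shift variable on the ball of radius `r`, followed by Tonelli. -/
lemma rpow_lintegral_meanOsc_le [MeasurableSpace F] [BorelSpace F] [SecondCountableTopology F]
    (hn : 1 ≤ n) {r : ℝ} (hr : 0 < r) {u : Euc n → F} (hu : Measurable u) :
    (∫⁻ x, meanOsc r u x ^ (n : ℝ)) ^ (1 / (n : ℝ))
      ≤ volume (Metric.ball (0 : Euc n) 1) ^ (((n : ℝ) - 1) / n) *
        ((ENNReal.ofReal r)⁻¹ * osc n r u ^ (1 / (n : ℝ))) := by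
  rw [← rpow_meanOsc_const hn (by simpa using hr) (by simp), osc_eq _ _ hu,
    ← volume_closedBall_euc n hr.le]
  gcongr
  have h1 : ((volume (Metric.closedBall (0 : Euc n) r)) ^ ((n : ℝ) - 1)) ≠ ⊤ :=
    ENNReal.rpow_ne_top_of_nonneg (by simpa using hn) measure_closedBall_lt_top.ne
  rw [← lintegral_const_mul' _ _ h1, ← lintegral_const_mul' _ _
    (ENNReal.rpow_ne_top_of_nonneg (by positivity) (ofReal_pow_inv_ne_top hr n))]
  refine lintegral_mono fun x => ?_
  rw [meanOsc, ENNReal.mul_rpow_of_nonneg _ _ (by positivity)]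
  gcongr
  refine (rpow_lintegral_le _ (by exact_mod_cast hn)
    ((measurable_shift_sub hu).comp measurable_prodMk_left).aemeasurable).trans_eq ?_
  simp

lemma meanOsc_le_of_holderWith {α H : ℝ≥0} {φ : Euc n → F} (hφ : HolderWith H α φ) {r : ℝ}
    (hr : 0 < r) (x : Euc n) :
    meanOsc r φ x ≤ volume (Metric.ball (0 : Euc n) 1) * (H * ENNReal.ofReal r ^ (α : ℝ)) := by
  have h : ∫⁻ t in Metric.closedBall (0 : Euc n) r, ‖φ (x - t) - φ x‖ₑ
      ≤ ∫⁻ t in Metric.closedBall (0 : Euc n) r, H * ENNReal.ofReal r ^ (α : ℝ) := by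
    refine setLIntegral_mono measurable_const fun t ht => ?_
    have h1 := hφ (x - t) x
    rw [edist_eq_enorm_sub, edist_eq_enorm_sub, sub_sub_cancel_left, enorm_neg] at h1
    refine h1.trans ?_
    gcongr
    rw [← ofReal_norm]
    exact ENNReal.ofReal_le_ofReal (mem_closedBall_zero_iff.1 ht)
  rw [setLIntegral_const, volume_closedBall_euc n hr.le] at h
  rw [meanOsc]
  refine (mul_le_mul_right h _).trans_eq ?_
  calc _ = ((ENNReal.ofReal r ^ n)⁻¹ * ENNReal.ofReal r ^ n) *
        (volume (Metric.ball (0 : Euc n) 1) * (H * ENNReal.ofReal r ^ (α : ℝ))) := by ring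
    _ = _ := by rw [ENNReal.inv_mul_cancel (by simp [hr]) (by simp), one_mul]

end Oscillation

variable {F : Type*} [NormedAddCommGroup F] [NormedSpace ℝ F]

/-- A smooth bump function supported in the unit ball. -/
noncomputable def unitBump (n : ℕ) : ContDiffBump (0 : Euc n) := ⟨1 / 2, 1, by norm_num, by norm_num⟩

/-- The standard mollifier at scale `r`. -/
noncomputable def mollKernel (n : ℕ) (r : ℝ) (x : Euc n) : ℝ :=
  (r ^ n)⁻¹ * (unitBump n).normed volume (r⁻¹ • x)

/-- Mollification at scale `r`. -/
noncomputable def moll (r : ℝ) (u : Euc n → F) : Euc n → F :=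
  convolution (mollKernel n r) u (ContinuousLinearMap.lsmul ℝ ℝ) volume

lemma moll_apply (r : ℝ) (u : Euc n → F) (x : Euc n) :
    moll r u x = ∫ t, mollKernel n r t • u (x - t) := rfl

lemma contDiff_mollKernel (r : ℝ) : ContDiff ℝ ∞ (mollKernel n r) :=
  contDiff_const.mul ((unitBump n).contDiff_normed.comp (contDiff_const_smul _))

lemma mollKernel_nonneg {r : ℝ} (hr : 0 < r) (x : Euc n) : 0 ≤ mollKernel n r x :=
  mul_nonneg (by positivity) ((unitBump n).nonneg_normed _)

lemma mollKernel_eq_zero {r : ℝ} (hr : 0 < r) {x : Euc n} (hx : x ∉ Metric.closedBall 0 r) :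
    mollKernel n r x = 0 := by
  have h : r⁻¹ • x ∉ Function.support ((unitBump n).normed volume) := by
    rw [ContDiffBump.support_normed_eq, mem_ball_zero_iff, norm_smul, norm_inv, Real.norm_of_nonneg hr.le]
    rw [mem_closedBall_zero_iff, not_le] at hx
    change ¬ (_ < (1 : ℝ))
    rw [not_lt, inv_mul_eq_div, one_le_div hr]
    exact hx.le
  rw [mollKernel, Function.notMem_support.1 h, mul_zero]

lemma hasCompactSupport_mollKernel {r : ℝ} (hr : 0 < r) : HasCompactSupport (mollKernel n r) :=
  HasCompactSupport.intro (isCompact_closedBall 0 r) fun _ hx => mollKernel_eq_zero hr hx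

lemma fderiv_mollKernel_eq_zero {r : ℝ} (hr : 0 < r) {x : Euc n}
    (hx : x ∉ Metric.closedBall 0 r) : fderiv ℝ (mollKernel n r) x = 0 := by
  by_contra h
  have h1 := support_fderiv_subset ℝ (f := mollKernel n r) (Function.mem_support.2 h)
  refine hx (closure_minimal ?_ Metric.isClosed_closedBall h1)
  intro y hy
  by_contra h2
  exact hy (mollKernel_eq_zero hr h2)

lemma integral_mollKernel {r : ℝ} (hr : 0 < r) : ∫ x, mollKernel n r x = 1 := by
  have h := Measure.integral_comp_smul (volume : Measure (Euc n))
    ((unitBump n).normed volume) r⁻¹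
  simp only [mollKernel]
  rw [integral_const_mul, h, ContDiffBump.integral_normed]
  simp only [finrank_euclideanSpace, Fintype.card_fin, smul_eq_mul, mul_one, inv_pow, inv_inv]
  rw [abs_of_pos (by positivity), inv_mul_cancel₀ (by positivity)]

lemma continuous_mollKernel (r : ℝ) : Continuous (mollKernel n r) :=
  (contDiff_mollKernel r).continuous

lemma integrable_mollKernel {r : ℝ} (hr : 0 < r) : Integrable (mollKernel n r) :=
  (continuous_mollKernel r).integrable_of_hasCompactSupport (hasCompactSupport_mollKernel hr)

lemma lintegral_enorm_mollKernel {r : ℝ} (hr : 0 < r) : ∫⁻ x, ‖mollKernel n r x‖ₑ = 1 := by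
  have h := ofReal_integral_eq_lintegral_ofReal (integrable_mollKernel (n := n) hr)
    (Eventually.of_forall fun x => mollKernel_nonneg hr x)
  rw [integral_mollKernel hr, ENNReal.ofReal_one] at h
  rw [h]
  exact lintegral_congr fun x => Real.enorm_of_nonneg (mollKernel_nonneg hr x)

/-- By scaling from the fixed profile, one constant serves all `r`; a derivative costs a factor
`r⁻¹`. -/
lemma exists_mollKernel_bound (n : ℕ) : ∃ M : ℝ≥0, ∀ r : ℝ, 0 < r → ∀ x : Euc n,
    ‖mollKernel n r x‖ₑ ≤ M * (ENNReal.ofReal r ^ n)⁻¹ ∧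
    ‖fderiv ℝ (mollKernel n r) x‖ₑ ≤ M * (ENNReal.ofReal r)⁻¹ * (ENNReal.ofReal r ^ n)⁻¹ := by
  set ρ : Euc n → ℝ := (unitBump n).normed volume with hρ
  have hρs : ContDiff ℝ ∞ ρ := (unitBump n).contDiff_normed
  have hρc : HasCompactSupport ρ := (unitBump n).hasCompactSupport_normed
  obtain ⟨M₁, h1⟩ := hρs.continuous.bounded_above_of_compact_support hρc
  obtain ⟨M₂, h2⟩ := (hρs.continuous_fderiv (by simp)).bounded_above_of_compact_support
    (hρc.fderiv ℝ)
  have e1 : ∀ x, ‖ρ x‖ₑ ≤ (max M₁ M₂).toNNReal := fun x => by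
    rw [← ofReal_norm]
    exact ENNReal.ofReal_le_ofReal ((h1 x).trans (le_max_left _ _))
  have e2 : ∀ x, ‖fderiv ℝ ρ x‖ₑ ≤ (max M₁ M₂).toNNReal := fun x => by
    rw [← ofReal_norm]
    exact ENNReal.ofReal_le_ofReal ((h2 x).trans (le_max_right _ _))
  have e3 : ∀ r : ℝ, 0 < r → ‖(r ^ n)⁻¹‖ₑ = (ENNReal.ofReal r ^ n)⁻¹ := fun r hr => by
    rw [Real.enorm_of_nonneg (by positivity), ENNReal.ofReal_inv_of_pos (by positivity),
      ENNReal.ofReal_pow hr.le]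
  refine ⟨(max M₁ M₂).toNNReal, fun r hr x => ⟨?_, ?_⟩⟩
  · rw [mollKernel, enorm_mul, e3 r hr, mul_comm]
    gcongr
    exact e1 _
  · have : fderiv ℝ (mollKernel n r) x = (r ^ n)⁻¹ • r⁻¹ • fderiv ℝ ρ (r⁻¹ • x) := by
      have hd : DifferentiableAt ℝ (fun x : Euc n => ρ (r⁻¹ • x)) x :=
        ((hρs.comp (contDiff_const_smul _)).differentiable (by simp)) x
      unfold mollKernel
      rw [fderiv_const_mul hd, fderiv_comp_smul]
    rw [this, enorm_smul, enorm_smul, e3 r hr, Real.enorm_of_nonneg (by positivity),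
      ENNReal.ofReal_inv_of_pos hr, mul_comm]
    rw [mul_comm (ENNReal.ofReal r)⁻¹]
    gcongr
    exact e2 _

lemma integrable_mollKernel_smul {r : ℝ} (hr : 0 < r) {u : Euc n → F}
    (hu : LocallyIntegrable u) (x : Euc n) :
    Integrable fun t => mollKernel n r t • u (x - t) :=
  (hasCompactSupport_mollKernel hr).convolutionExists_left (ContinuousLinearMap.lsmul ℝ ℝ)
    (continuous_mollKernel r) hu x

lemma contDiff_moll [CompleteSpace F] {r : ℝ} (hr : 0 < r) {u : Euc n → F}
    (hu : LocallyIntegrable u) : ContDiff ℝ ∞ (moll r u) :=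
  (hasCompactSupport_mollKernel hr).contDiff_convolution_left (n := ⊤) _ (contDiff_mollKernel r) hu

lemma hasCompactSupport_moll {r : ℝ} (hr : 0 < r) {u : Euc n → F} (hu : HasCompactSupport u) :
    HasCompactSupport (moll r u) :=
  HasCompactSupport.convolution _ (hasCompactSupport_mollKernel hr) hu

lemma moll_sub {r : ℝ} (hr : 0 < r) {u v : Euc n → F} (hu : LocallyIntegrable u)
    (hv : LocallyIntegrable v) (x : Euc n) :
    moll r (fun y => u y - v y) x = moll r u x - moll r v x := by
  simp only [moll_apply, smul_sub]
  exact integral_sub (integrable_mollKernel_smul hr hu x) (integrable_mollKernel_smul hr hv x)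

lemma moll_const [CompleteSpace F] {r : ℝ} (hr : 0 < r) (c : F) (x : Euc n) :
    moll r (fun _ => c) x = c := by
  rw [moll_apply, integral_smul_const, integral_mollKernel hr, one_smul]

/-- The kernel has integral one, so mollification preserves constants. Subtracting the constant `u
x` changes neither `moll r u x - u x` nor the gradient, and leaves the kernel, or its derivative,
integrated against `u (x - t) - u x`. -/
lemma exists_moll_bound (n : ℕ) (F : Type*) [NormedAddCommGroup F] [NormedSpace ℝ F]
    [CompleteSpace F] :
    ∃ M : ℝ≥0, ∀ r : ℝ, 0 < r → ∀ u : Euc n → F, LocallyIntegrable u → ∀ x : Euc n,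
      ‖moll r u x - u x‖ₑ ≤ M * meanOsc r u x ∧
      ‖fderiv ℝ (moll r u) x‖ₑ ≤ M * (ENNReal.ofReal r)⁻¹ * meanOsc r u x := by
  obtain ⟨M, hM⟩ := exists_mollKernel_bound n
  refine ⟨M, fun r hr u hu x => ?_⟩
  have hcl : LocallyIntegrable (fun _ : Euc n => u x) (volume : Measure (Euc n)) :=
    continuous_const.locallyIntegrable
  have hul : LocallyIntegrable (fun y => u y - u x) := hu.sub hcl
  have hsub : ∀ y, moll r (fun y => u y - u x) y = moll r u y - u x := fun y => by
    rw [moll_sub hr hu hcl, moll_const hr]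
  constructor
  · rw [← hsub, moll_apply]
    refine (enorm_integral_le_lintegral_enorm _).trans ?_
    simp_rw [enorm_smul]
    exact lintegral_mul_le_meanOsc u x (K := fun t => ‖mollKernel n r t‖ₑ)
      (fun t ht => by simp [mollKernel_eq_zero hr ht]) (fun t => (hM r hr t).1)
      (ENNReal.mul_ne_top (by simp) (ofReal_pow_inv_ne_top hr n))
  · have h1 : fderiv ℝ (moll r u) x = fderiv ℝ (moll r (fun y => u y - u x)) x := by
      rw [funext hsub, fderiv_sub_const]
    have h2 := (hasCompactSupport_mollKernel (n := n) hr).hasFDerivAt_convolution_left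
      (ContinuousLinearMap.lsmul ℝ ℝ) ((contDiff_mollKernel r).of_le (by simp)) hul x
    rw [h1, moll, h2.fderiv, convolution_def]
    refine (enorm_integral_le_lintegral_enorm _).trans ?_
    refine le_trans (lintegral_mono (g := fun t => ‖fderiv ℝ (mollKernel n r) t‖ₑ *
      ‖u (x - t) - u x‖ₑ) fun t => ?_) ?_
    · have : ‖((ContinuousLinearMap.lsmul ℝ ℝ).precompL (Euc n) (fderiv ℝ (mollKernel n r) t))
          (u (x - t) - u x)‖ ≤ ‖fderiv ℝ (mollKernel n r) t‖ * ‖u (x - t) - u x‖ := by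
        refine ContinuousLinearMap.opNorm_le_bound _ (by positivity) fun v => ?_
        rw [ContinuousLinearMap.precompL_apply, ContinuousLinearMap.lsmul_apply, norm_smul,
          mul_right_comm]
        gcongr
        exact ContinuousLinearMap.le_opNorm _ _
      have h := ENNReal.ofReal_le_ofReal this
      rw [ENNReal.ofReal_mul (norm_nonneg _)] at h
      simpa only [ofReal_norm] using h
    · exact lintegral_mul_le_meanOsc u x (K := fun t => ‖fderiv ℝ (mollKernel n r) t‖ₑ)
        (fun t ht => by
          rw [← ofReal_norm, fderiv_mollKernel_eq_zero hr ht, norm_zero, ENNReal.ofReal_zero]) (fun t => (hM r hr t).2)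
        (ENNReal.mul_ne_top (ENNReal.mul_ne_top (by simp) (by simp [hr]))
          (ofReal_pow_inv_ne_top hr n))

lemma exists_eLpNorm_moll_bound (n : ℕ) (hn : 1 ≤ n) (F : Type*) [NormedAddCommGroup F]
    [NormedSpace ℝ F] [CompleteSpace F] [MeasurableSpace F] [BorelSpace F]
    [SecondCountableTopology F] :
    ∃ M : ℝ≥0, ∀ r : ℝ, 0 < r → ∀ u : Euc n → F, LocallyIntegrable u → Measurable u →
      eLpNorm (fun x => moll r u x - u x) n volume
        ≤ M * ((ENNReal.ofReal r)⁻¹ * osc n r u ^ (1 / (n : ℝ))) ∧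
      eLpNorm (fderiv ℝ (moll r u)) n volume
        ≤ M * ((ENNReal.ofReal r)⁻¹ * ((ENNReal.ofReal r)⁻¹ * osc n r u ^ (1 / (n : ℝ)))) := by
  obtain ⟨M, hM⟩ := exists_moll_bound n F
  have hc : volume (Metric.ball (0 : Euc n) 1) ^ (((n : ℝ) - 1) / n) ≠ ⊤ :=
    ENNReal.rpow_ne_top_of_nonneg (div_nonneg (by simpa using hn) (by positivity))
      measure_ball_lt_top.ne
  have hn0 : (n : ℝ) ≠ 0 := by positivity
  have key : ∀ r : ℝ, 0 < r → ∀ u : Euc n → F, Measurable u → ∀ {G : Type _}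
      [NormedAddCommGroup G] (g : Euc n → G) (a : ℝ≥0∞) (_ : a ≠ ⊤),
      (∀ x, ‖g x‖ₑ ≤ a * meanOsc r u x) → eLpNorm g n volume ≤
        a * (volume (Metric.ball (0 : Euc n) 1) ^ (((n : ℝ) - 1) / n) *
          ((ENNReal.ofReal r)⁻¹ * osc n r u ^ (1 / (n : ℝ)))) := by
    intro r hr u hu G _ g a ha hg
    rw [eLpNorm_natCast_eq hn]
    calc (∫⁻ x, ‖g x‖ₑ ^ (n : ℝ)) ^ (1 / (n : ℝ))
        ≤ (∫⁻ x, a ^ (n : ℝ) * meanOsc r u x ^ (n : ℝ)) ^ (1 / (n : ℝ)) := by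
          gcongr with x
          rw [← ENNReal.mul_rpow_of_nonneg _ _ (by positivity)]
          gcongr
          exact hg x
      _ = a * (∫⁻ x, meanOsc r u x ^ (n : ℝ)) ^ (1 / (n : ℝ)) := by
          rw [lintegral_const_mul' _ _ (ENNReal.rpow_ne_top_of_nonneg (by positivity) ha),
            ENNReal.mul_rpow_of_nonneg _ _ (by positivity), ← ENNReal.rpow_mul,
            mul_one_div_cancel hn0, ENNReal.rpow_one]
      _ ≤ _ := by
          gcongr
          exact rpow_lintegral_meanOsc_le hn hr hu
  refine ⟨M * (volume (Metric.ball (0 : Euc n) 1) ^ (((n : ℝ) - 1) / n)).toNNReal,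
    fun r hr u hul hu => ⟨?_, ?_⟩⟩
  · refine (key r hr u hu _ M (by simp) fun x => (hM r hr u hul x).1).trans_eq ?_
    rw [ENNReal.coe_mul, ENNReal.coe_toNNReal hc, mul_assoc]
  · refine (key r hr u hu _ (M * (ENNReal.ofReal r)⁻¹)
      (ENNReal.mul_ne_top (by simp) (by simp [hr])) fun x => (hM r hr u hul x).2).trans_eq ?_
    rw [ENNReal.coe_mul, ENNReal.coe_toNNReal hc]
    ring

lemma exists_moll_holder_bound (n : ℕ) : ∃ M : ℝ≥0, ∀ r : ℝ, 0 < r → ∀ (α H : ℝ≥0)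
    (φ : Euc n → ℝ), Continuous φ → HolderWith H α φ → ∀ x,
      ‖φ x - moll r φ x‖ₑ ≤ M * (H * ENNReal.ofReal r ^ (α : ℝ)) ∧
      ‖fderiv ℝ (moll r φ) x‖ₑ
        ≤ M * ((ENNReal.ofReal r)⁻¹ * (H * ENNReal.ofReal r ^ (α : ℝ))) := by
  obtain ⟨M, hM⟩ := exists_moll_bound n ℝ
  have hc : volume (Metric.ball (0 : Euc n) 1) ≠ ⊤ := measure_ball_lt_top.ne
  refine ⟨M * (volume (Metric.ball (0 : Euc n) 1)).toNNReal, fun r hr α H φ hφc hφ x => ⟨?_, ?_⟩⟩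
  · rw [← enorm_neg, neg_sub, ENNReal.coe_mul, ENNReal.coe_toNNReal hc, mul_assoc]
    refine (hM r hr φ hφc.locallyIntegrable x).1.trans ?_
    gcongr
    exact meanOsc_le_of_holderWith hφ hr x
  · refine (hM r hr φ hφc.locallyIntegrable x).2.trans ?_
    rw [ENNReal.coe_mul, ENNReal.coe_toNNReal hc]
    calc _ ≤ M * (ENNReal.ofReal r)⁻¹ * (volume (Metric.ball (0 : Euc n) 1) *
          (H * ENNReal.ofReal r ^ (α : ℝ))) := by
          gcongr
          exact meanOsc_le_of_holderWith hφ hr x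
      _ = _ := by ring

/-- Young's inequality for mollifications. -/
lemma lintegral_moll_rpow_le [MeasurableSpace F] [BorelSpace F] {p r : ℝ} (hp : 1 ≤ p)
    (hr : 0 < r) {u : Euc n → F} (hu : Measurable u) :
    ∫⁻ x, ‖moll r u x‖ₑ ^ p ≤ ∫⁻ x, ‖u x‖ₑ ^ p := by
  have hK : Measurable fun t => ‖mollKernel n r t‖ₑ := (continuous_mollKernel r).enorm.measurable
  -- The kernel is the density of a probability measure, so Jensen bounds the `p`-th power of the
  -- average; Tonelli and translation invariance do the rest.
  set μ : Measure (Euc n) := volume.withDensity fun t => ‖mollKernel n r t‖ₑ with hμ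
  have hμ1 : μ Set.univ = 1 := by
    rw [hμ, withDensity_apply _ MeasurableSet.univ, Measure.restrict_univ,
      lintegral_enorm_mollKernel hr]
  have hm : Measurable fun z : Euc n × Euc n => ‖u (z.1 - z.2)‖ₑ :=
    (hu.comp (measurable_fst.sub measurable_snd)).enorm
  have hm' : ∀ x, Measurable fun t => ‖u (x - t)‖ₑ := fun x => hm.comp measurable_prodMk_left
  calc ∫⁻ x, ‖moll r u x‖ₑ ^ p
      ≤ ∫⁻ x, ∫⁻ t, ‖mollKernel n r t‖ₑ * ‖u (x - t)‖ₑ ^ p := by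
        refine lintegral_mono fun x => ?_
        have h1 : ‖moll r u x‖ₑ ≤ ∫⁻ t, ‖u (x - t)‖ₑ ∂μ := by
          rw [hμ, lintegral_withDensity_eq_lintegral_mul _ hK (hm' x), moll_apply]
          refine (enorm_integral_le_lintegral_enorm _).trans_eq ?_
          simp_rw [enorm_smul]
          rfl
        refine (ENNReal.rpow_le_rpow h1 (by positivity)).trans ?_
        refine (rpow_lintegral_le μ hp (hm' x).aemeasurable).trans_eq ?_
        rw [hμ1, ENNReal.one_rpow, one_mul, hμ,
          lintegral_withDensity_eq_lintegral_mul _ hK ((hm' x).pow_const p)]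
        rfl
    _ = ∫⁻ t, ∫⁻ x, ‖mollKernel n r t‖ₑ * ‖u (x - t)‖ₑ ^ p :=
        lintegral_lintegral_swap ((hK.comp measurable_snd).mul (hm.pow_const p)).aemeasurable
    _ = ∫⁻ t, ‖mollKernel n r t‖ₑ * ∫⁻ x, ‖u x‖ₑ ^ p := by
        refine lintegral_congr fun t => ?_
        rw [lintegral_const_mul' _ _ (by simp),
          lintegral_sub_right_eq_self (fun x => ‖u x‖ₑ ^ p) t]
    _ = ∫⁻ x, ‖u x‖ₑ ^ p := by
        rw [lintegral_mul_const _ hK, lintegral_enorm_mollKernel hr, one_mul]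

end Mollification

/-! ### Shift energies and their summation over dyadic scales. -/

section Translations

variable {n : ℕ} {F : Type*} [NormedAddCommGroup F]

section Measurable

variable [MeasurableSpace F] [BorelSpace F] [SecondCountableTopology F]

lemma measurable_shiftEnergy (p : ℝ) {u : Euc n → F} (hu : Measurable u) :
    Measurable (shiftEnergy p u) :=
  (((measurable_shift_sub hu).comp measurable_swap).pow_const p).lintegral_prod_right'

/-- The Gagliardo seminorm in terms of translations. -/
lemma gagliardoSeminorm_eq_shiftEnergy (β p : ℝ) {u : Euc n → F} (hu : Measurable u) :
    gagliardoSeminorm β p u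
      = (∫⁻ t, shiftEnergy p u t / ‖t‖ₑ ^ ((n : ℝ) + β * p)) ^ (1 / p) := by
  unfold gagliardoSeminorm
  congr 1
  have h1 : ∀ x, ∫⁻ y, ‖u x - u y‖ₑ ^ p / ‖x - y‖ₑ ^ ((n : ℝ) + β * p)
      = ∫⁻ t, ‖u (x - t) - u x‖ₑ ^ p / ‖t‖ₑ ^ ((n : ℝ) + β * p) := by
    intro x
    rw [← lintegral_sub_left_eq_self _ x]
    refine lintegral_congr fun t => ?_
    rw [sub_sub_cancel, ← enorm_neg (u x - u (x - t)), neg_sub]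
  simp_rw [h1]
  rw [lintegral_lintegral_swap]
  · refine lintegral_congr fun t => ?_
    simp_rw [div_eq_mul_inv]
    rw [lintegral_mul_const]
    · rfl
    · exact ((measurable_shift_sub hu).comp measurable_prodMk_right).pow_const p
  · exact (((measurable_shift_sub hu).pow_const p).div
      (measurable_snd.enorm.pow_const _)).aemeasurable

end Measurable

lemma shiftEnergy_zero {p : ℝ} (hp : 0 < p) (u : Euc n → F) : shiftEnergy p u 0 = 0 := by
  simp [shiftEnergy, hp]

/-- The minimum is what makes the induction close: when the term `a * q ^ N` is counted, the first
bound absorbs it exactly and it is at most `D`; when it is not, the bound `D` simply persists. -/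
lemma sum_geom_le {q : ℝ} (hq : 1 < q) {a D : ℝ} (ha : 0 < a) (hD : 0 ≤ D) (N : ℕ) :
    (1 - q⁻¹) * ∑ j ∈ Finset.range N, (if a * q ^ j ≤ D then a * q ^ j else 0)
      ≤ min (a * q ^ N * q⁻¹) D := by
  have hq0 : 0 < q := by linarith
  have hq1 : 0 < q⁻¹ := by positivity
  induction N with
  | zero => simp; constructor <;> positivity
  | succ N ih =>
    rw [Finset.sum_range_succ, mul_add]
    have e : a * q ^ (N + 1) * q⁻¹ = a * q ^ N := by
      rw [pow_succ]; field_simp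
    rw [e]
    have hp : 0 < a * q ^ N := by positivity
    obtain ⟨h1, h2⟩ := le_min_iff.1 ih
    have h3 : a * q ^ N * q⁻¹ ≤ a * q ^ N := mul_le_of_le_one_right hp.le (inv_le_one_of_one_le₀ hq.le)
    split_ifs with h
    · refine le_min ?_ ?_ <;> nlinarith
    · refine le_min ?_ ?_ <;> linarith

/-- The weights increase geometrically as the scale decreases, and only scales at least `d`
contribute, so the sum is comparable to its largest possible term, uniformly in `R` and `N`. -/
lemma sum_dyadic_le {s : ℝ} (hs : 0 < s) : ∃ C : ℝ≥0, ∀ (R : ℝ), 0 < R → ∀ (N : ℕ) (d : ℝ), 0 < d →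
    ∑ j ∈ Finset.range N, (if d ≤ R * (1 / 2) ^ j then ENNReal.ofReal (R * (1 / 2) ^ j) ^ (-s) else 0)
      ≤ C * (ENNReal.ofReal d ^ s)⁻¹ := by
  set q : ℝ := 2 ^ s with hq
  have hq1 : 1 < q := Real.one_lt_rpow (by norm_num) hs
  have hc : 0 < 1 - q⁻¹ := sub_pos.2 (inv_lt_one_of_one_lt₀ hq1)
  refine ⟨((1 - q⁻¹)⁻¹).toNNReal, fun R hR N d hd => ?_⟩
  have hpow : ∀ j : ℕ, (R * (1 / 2) ^ j) ^ (-s) = R ^ (-s) * q ^ j := by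
    intro j
    rw [Real.mul_rpow hR.le (by positivity), hq, ← Real.rpow_natCast, ← Real.rpow_natCast,
      ← Real.rpow_mul (by norm_num), ← Real.rpow_mul (by norm_num), one_div,
      Real.inv_rpow (by norm_num), ← Real.rpow_neg (by norm_num)]
    congr 2
    ring
  have h1 := (sum_geom_le hq1 (a := R ^ (-s)) (D := d ^ (-s)) (by positivity) (by positivity) N).trans
    (min_le_right _ _)
  rw [← le_div_iff₀' hc, div_eq_inv_mul] at h1
  have h2 := ENNReal.ofReal_le_ofReal h1
  rw [ENNReal.ofReal_mul (by positivity), ENNReal.ofReal_sum_of_nonneg] at h2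
  · have h3 : ENNReal.ofReal (d ^ (-s)) = (ENNReal.ofReal d ^ s)⁻¹ := by
      rw [← ENNReal.ofReal_rpow_of_pos hd, ENNReal.rpow_neg]
    rw [h3] at h2
    refine le_trans (Finset.sum_le_sum fun j _ => ?_) h2
    have hRj : 0 < R * (1 / 2) ^ j := by positivity
    by_cases h : d ≤ R * (1 / 2) ^ j
    · have : R ^ (-s) * q ^ j ≤ d ^ (-s) := by
        rw [← hpow]
        exact Real.rpow_le_rpow_of_nonpos hd h (by linarith)
      rw [if_pos h, if_pos this, ← hpow, ENNReal.ofReal_rpow_of_pos hRj]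
    · rw [if_neg h]; exact zero_le
  · intro j _
    split_ifs <;> positivity

/-- The energies at dyadic scales are summable against the Gagliardo weight. -/
lemma exists_sum_osc_le [MeasurableSpace F] [BorelSpace F] [SecondCountableTopology F]
    {s p : ℝ} (hs : 0 < s) (hp : 0 < p) : ∃ C : ℝ≥0, ∀ (R : ℝ), 0 < R → ∀ (N : ℕ)
    (u : Euc n → F), Measurable u →
    ∑ j ∈ Finset.range N, ENNReal.ofReal (R * (1 / 2) ^ j) ^ (-s) * osc p (R * (1 / 2) ^ j) u
      ≤ C * ∫⁻ t, shiftEnergy p u t / ‖t‖ₑ ^ s := by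
  obtain ⟨C, hC⟩ := sum_dyadic_le hs
  refine ⟨C, fun R hR N u hu => ?_⟩
  have hE := measurable_shiftEnergy p hu
  have h1 : ∀ j, ENNReal.ofReal (R * (1 / 2) ^ j) ^ (-s) * osc p (R * (1 / 2) ^ j) u
      = ∫⁻ t, (if ‖t‖ ≤ R * (1 / 2) ^ j then ENNReal.ofReal (R * (1 / 2) ^ j) ^ (-s) else 0)
          * shiftEnergy p u t := by
    intro j
    rw [osc, ← lintegral_indicator Metric.isClosed_closedBall.measurableSet, ← lintegral_const_mul]
    · refine lintegral_congr fun t => ?_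
      by_cases h : ‖t‖ ≤ R * (1 / 2) ^ j
      · rw [if_pos h, Set.indicator_of_mem (mem_closedBall_zero_iff.2 h)]
      · rw [if_neg h, Set.indicator_of_notMem (by rwa [mem_closedBall_zero_iff]), mul_zero, zero_mul]
    · exact hE.indicator Metric.isClosed_closedBall.measurableSet
  simp_rw [h1]
  rw [← lintegral_finsetSum, ← lintegral_const_mul' _ _ ENNReal.coe_ne_top]
  · refine lintegral_mono fun t => ?_
    simp only
    rw [← Finset.sum_mul]
    -- The dyadic bound needs a positive distance; at `t = 0` the shift energy vanishes.
    by_cases ht : t = 0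
    · subst ht; simp [shiftEnergy_zero hp]
    · have := hC R hR N ‖t‖ (norm_pos_iff.2 ht)
      rw [ofReal_norm] at this
      refine (mul_le_mul_left this _).trans_eq ?_
      rw [div_eq_mul_inv]; ring
  · intro j _
    exact (Measurable.ite (measurableSet_le measurable_norm measurable_const) measurable_const
      measurable_const).mul hE

/-- Hölder for the counting measure. It lets every component be summed over the scales separately,
so that each contributes its own seminorm. -/
lemma sum_prod_rpow_le (hn : 1 ≤ n) (N : ℕ) (X : Fin n → ℕ → ℝ≥0∞) :
    ∑ j ∈ Finset.range N, ∏ i, X i j ^ (1 / (n : ℝ))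
      ≤ ∏ i, (∑ j ∈ Finset.range N, X i j) ^ (1 / (n : ℝ)) := by
  have hn0 : (n : ℝ) ≠ 0 := by positivity
  have h := lintegral_prod_le (μ := (Measure.count : Measure (Fin N))) hn
    (g := fun i j => X i j ^ (1 / (n : ℝ))) fun i => (measurable_of_finite _).aemeasurable
  simp only [lintegral_count, tsum_fintype, ← ENNReal.rpow_mul, one_div_mul_cancel hn0,
    ENNReal.rpow_one] at h
  simpa only [Finset.sum_range] using h

end Translations

/-! ### The pairing at a given scale and its change between neighbouring scales. -/

section Scales

variable {n : ℕ}

section Bounds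

variable {F : Type*} [NormedAddCommGroup F]

lemma osc_mono (p : ℝ) {r r' : ℝ} (h : r ≤ r') (u : Euc n → F) : osc p r u ≤ osc p r' u :=
  lintegral_mono_set (Metric.closedBall_subset_closedBall h)

lemma lintegral_enorm_sub_rpow_le {X : Type*} [MeasurableSpace X] {μ : Measure X} {p : ℝ}
    (hp : 1 ≤ p) {f g : X → F} (hf : AEMeasurable (fun x => ‖f x‖ₑ ^ p) μ) :
    ∫⁻ x, ‖f x - g x‖ₑ ^ p ∂μ
      ≤ 2 ^ (p - 1) * (∫⁻ x, ‖f x‖ₑ ^ p ∂μ + ∫⁻ x, ‖g x‖ₑ ^ p ∂μ) := by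
  rw [← lintegral_add_left' hf, ← lintegral_const_mul' _ _
    (ENNReal.rpow_ne_top_of_nonneg (by linarith) (by simp))]
  refine lintegral_mono fun x => ?_
  refine (ENNReal.rpow_le_rpow (enorm_sub_le) (by positivity)).trans ?_
  exact ENNReal.rpow_add_le_mul_rpow_add_rpow _ _ hp

lemma shiftEnergy_le [MeasurableSpace F] [BorelSpace F] {p : ℝ} (hp : 1 ≤ p) {u : Euc n → F}
    (hu : Measurable u) (t : Euc n) : shiftEnergy p u t ≤ 2 ^ p * ∫⁻ x, ‖u x‖ₑ ^ p := by
  refine (lintegral_enorm_sub_rpow_le hp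
    ((hu.comp (measurable_id.sub_const t)).enorm.pow_const p).aemeasurable).trans_eq ?_
  simp only [Function.comp_def, id]
  have h2 : (2 : ℝ≥0∞) ^ p = 2 ^ (p - 1) * 2 := by
    simpa using ENNReal.rpow_add (x := 2) (p - 1) 1 (by norm_num) (by norm_num)
  rw [lintegral_sub_right_eq_self (fun x => ‖u x‖ₑ ^ p) t, ← two_mul, ← mul_assoc, h2]

lemma osc_le [MeasurableSpace F] [BorelSpace F] {p : ℝ} (hp : 1 ≤ p) {u : Euc n → F}
    (hu : Measurable u) {r : ℝ} (hr : 0 < r) :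
    osc p r u ≤ 2 ^ p * (∫⁻ x, ‖u x‖ₑ ^ p) *
      (ENNReal.ofReal r ^ n * volume (Metric.ball (0 : Euc n) 1)) := by
  rw [← volume_closedBall_euc n hr.le, ← setLIntegral_const]
  exact lintegral_mono fun t => shiftEnergy_le hp hu t

/-- Purely qualitative: `C` depends on `u`, and serves only to pass to the limit `r → 0`. The
restriction `r ≤ 1` keeps the shifted supports in one fixed ball. -/
lemma exists_osc_le_of_lipschitz {K : ℝ≥0} {u : Euc n → F} (hu : LipschitzWith K u)
    (huc : HasCompactSupport u) {p : ℝ} (hp : 0 < p) : ∃ C : ℝ≥0∞, C ≠ ⊤ ∧ ∀ r : ℝ, 0 < r → r ≤ 1 →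
      osc p r u ≤ C * (ENNReal.ofReal r ^ p * ENNReal.ofReal r ^ n) := by
  obtain ⟨A, hA⟩ := huc.isCompact.isBounded.subset_closedBall (0 : Euc n)
  set S := Metric.closedBall (0 : Euc n) (A + 1) with hS
  have hStop : volume S ≠ ⊤ := measure_closedBall_lt_top.ne
  have hK : ((K : ℝ≥0∞) ^ p) ≠ ⊤ := ENNReal.rpow_ne_top_of_nonneg hp.le (by simp)
  refine ⟨K ^ p * volume S * volume (Metric.ball (0 : Euc n) 1),
    ENNReal.mul_ne_top (ENNReal.mul_ne_top hK hStop) measure_ball_lt_top.ne, fun r hr hr1 => ?_⟩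
  have h1 : ∀ t ∈ Metric.closedBall (0 : Euc n) r,
      shiftEnergy p u t ≤ (K * ENNReal.ofReal r) ^ p * volume S := by
    intro t ht
    rw [mem_closedBall_zero_iff] at ht
    rw [shiftEnergy, ← setLIntegral_const, ← lintegral_indicator Metric.isClosed_closedBall.measurableSet]
    refine lintegral_mono fun x => ?_
    by_cases hx : x ∈ S
    · rw [Set.indicator_of_mem hx]
      gcongr
      have h := hu (x - t) x
      rw [edist_eq_enorm_sub, edist_eq_enorm_sub, sub_sub_cancel_left, enorm_neg] at h
      refine h.trans ?_
      gcongr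
      rw [← ofReal_norm]
      exact ENNReal.ofReal_le_ofReal ht
    · have hx' : A + 1 < ‖x‖ := by simpa [hS] using hx
      have e1 : u x = 0 := image_eq_zero_of_notMem_tsupport fun h => by
        have := mem_closedBall_zero_iff.1 (hA h); linarith
      have e2 : u (x - t) = 0 := image_eq_zero_of_notMem_tsupport fun h => by
        have := mem_closedBall_zero_iff.1 (hA h)
        have := norm_sub_norm_le x t
        linarith
      simp [e1, e2, hp]
  refine (setLIntegral_mono measurable_const h1).trans_eq ?_
  rw [setLIntegral_const, volume_closedBall_euc n hr.le, ENNReal.mul_rpow_of_nonneg _ _ hp.le]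
  ring

end Bounds

/-- The Jacobian pairing of the mollifications at scale `r`. -/
noncomputable def mollPairing (u : Fin n → Euc n → ℝ) (φ : Euc n → ℝ) (r : ℝ) : ℝ :=
  ∫ x, jac (fun i => moll r (u i)) x * moll r φ x

/-- The relation between `α` and `β` enters the exponents here: each factor receives `R^(α/n - 2) =
R^(-(1+β))`. -/
lemma prod_scaling (hn : 1 ≤ n) {α β : ℝ} (hαβ : α / n = 1 - β) {R : ℝ≥0∞} (hR : R ≠ 0)
    (hR' : R ≠ ⊤) (O : Fin n → ℝ≥0∞) :
    R ^ α * ∏ i, (R⁻¹ * (R⁻¹ * O i ^ (1 / (n : ℝ))))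
      = ∏ i, (R ^ (-((n : ℝ) + β * n)) * O i) ^ (1 / (n : ℝ)) := by
  have hn0 : (n : ℝ) ≠ 0 := by positivity
  have h1 : R ^ α = ∏ _i : Fin n, R ^ (α / n) := by
    rw [Finset.prod_const, Finset.card_univ, Fintype.card_fin, ← ENNReal.rpow_natCast,
      ← ENNReal.rpow_mul, div_mul_cancel₀ _ hn0]
  rw [h1, ← Finset.prod_mul_distrib]
  refine Finset.prod_congr rfl fun i _ => ?_
  rw [ENNReal.mul_rpow_of_nonneg _ _ (by positivity), ← ENNReal.rpow_mul, ← mul_assoc, ← mul_assoc,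
    ← ENNReal.rpow_neg_one, ← ENNReal.rpow_add _ _ hR hR', ← ENNReal.rpow_add _ _ hR hR', hαβ]
  congr 2
  field_simp
  ring

/-- Fixed-scale stability applied to the mollifications at `r/2` and `r`. Both are within the
mollification error of the original function, hence close to each other. -/
lemma exists_mollPairing_step (hn : 1 ≤ n) {α : ℝ≥0} {β : ℝ} (hαβ : (α : ℝ) / n = 1 - β) :
    ∃ C : ℝ≥0, ∀ (u : Fin n → Euc n → ℝ), (∀ i, ContDiff ℝ ∞ (u i)) →
      (∀ i, HasCompactSupport (u i)) → ∀ (φ : Euc n → ℝ) (H : ℝ≥0), Continuous φ →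
      HolderWith H α φ → ∀ r : ℝ, 0 < r →
      ‖mollPairing u φ (r * (1 / 2)) - mollPairing u φ r‖ₑ
        ≤ C * H * ∏ i, (ENNReal.ofReal r ^ (-((n : ℝ) + β * n)) * osc n r (u i)) ^ (1 / (n : ℝ)) := by
  obtain ⟨M, hM⟩ := exists_eLpNorm_moll_bound n hn ℝ
  obtain ⟨M', hM'⟩ := exists_moll_holder_bound n
  refine ⟨n.factorial * (2 * M' + n * M') * (4 * M) ^ n, fun u hu huc φ H hφc hφ r hr => ?_⟩
  set R := ENNReal.ofReal r with hRdef
  have hR : R ≠ 0 := by simpa [hRdef] using hr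
  have hR' : R ≠ ⊤ := by simp [hRdef]
  have hr2 : 0 < r * (1 / 2) := by positivity
  have hinv : (ENNReal.ofReal (r * (1 / 2)))⁻¹ = 2 * R⁻¹ := by
    rw [ENNReal.ofReal_mul hr.le, ENNReal.mul_inv (Or.inl hR) (Or.inl hR'), mul_comm,
      ← ENNReal.ofReal_inv_of_pos (by norm_num)]
    norm_num
  have hle : ENNReal.ofReal (r * (1 / 2)) ≤ R := ENNReal.ofReal_le_ofReal (by linarith)
  have hul : ∀ i, LocallyIntegrable (u i) := fun i => (hu i).continuous.locallyIntegrable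
  have hum : ∀ i, Measurable (u i) := fun i => (hu i).continuous.measurable
  have hO : ∀ i, osc n (r * (1 / 2)) (u i) ^ (1 / (n : ℝ)) ≤ osc n r (u i) ^ (1 / (n : ℝ)) :=
    fun i => by
      gcongr
      exact osc_mono _ (by linarith) _
  set X : Fin n → ℝ≥0∞ := fun i => osc n r (u i) ^ (1 / (n : ℝ)) with hX
  have hX2 : ∀ i, osc n (r * (1 / 2)) (u i) ^ (1 / (n : ℝ)) ≤ X i := hO
  -- The product `L * R` has the same size `H * R^α` as `m`. The 4 in `B` is the square of the 2 in
  -- `(r/2)⁻¹ = 2 R⁻¹`, needed for the gradient at scale `r/2`; it also covers the factor 2 + 1 in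
  -- the difference of the two mollifications.
  have key := enorm_integral_jac_mul_sub_le hn (f := fun i => moll (r * (1 / 2)) (u i))
    (g := fun i => moll r (u i)) (fun i => contDiff_moll hr2 (hul i))
    (fun i => hasCompactSupport_moll hr2 (huc i)) (fun i => contDiff_moll hr (hul i))
    (fun i => hasCompactSupport_moll hr (huc i)) (f₀ := moll (r * (1 / 2)) φ) (g₀ := moll r φ)
    (contDiff_moll hr2 hφc.locallyIntegrable).continuous (contDiff_moll hr hφc.locallyIntegrable)
    (m := 2 * M' * (H * R ^ (α : ℝ))) (L := M' * (R⁻¹ * (H * R ^ (α : ℝ)))) (r := R)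
    (B := fun i => 4 * M * (R⁻¹ * (R⁻¹ * X i))) ?_ ?_ ?_ ?_ ?_
  · refine key.trans_eq ?_
    have e1 : M' * (R⁻¹ * (H * R ^ (α : ℝ))) * R = M' * (H * R ^ (α : ℝ)) := by
      calc _ = M' * ((R⁻¹ * R) * (H * R ^ (α : ℝ))) := by ring
        _ = _ := by rw [ENNReal.inv_mul_cancel hR hR', one_mul]
    rw [← prod_scaling hn hαβ hR hR', e1, Finset.prod_mul_distrib, Finset.prod_const,
      Finset.card_univ, Fintype.card_fin]
    push_cast
    ring
  · intro x
    have h1 := (hM' (r * (1 / 2)) hr2 α H φ hφc hφ x).1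
    have h2 := (hM' r hr α H φ hφc hφ x).1
    have h3 : moll (r * (1 / 2)) φ x - moll r φ x
        = (φ x - moll r φ x) - (φ x - moll (r * (1 / 2)) φ x) := by ring
    rw [h3, mul_assoc, two_mul]
    refine enorm_sub_le.trans (add_le_add h2 (h1.trans ?_))
    gcongr
  · exact fun x => (hM' r hr α H φ hφc hφ x).2
  · intro i
    refine (hM _ hr2 (u i) (hul i) (hum i)).2.trans ?_
    rw [hinv]
    calc _ ≤ (M : ℝ≥0∞) * (2 * R⁻¹ * (2 * R⁻¹ * X i)) := by gcongr; exact hX2 i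
      _ = _ := by ring
  · intro i
    refine (hM _ hr (u i) (hul i) (hum i)).2.trans ?_
    calc _ ≤ 4 * ((M : ℝ≥0∞) * (R⁻¹ * (R⁻¹ * X i))) := le_mul_of_one_le_left zero_le (by norm_num)
      _ = _ := by ring
  · intro i
    have h1 := (hM _ hr2 (u i) (hul i) (hum i)).1
    have h2 := (hM _ hr (u i) (hul i) (hum i)).1
    have h3 : (fun x => moll (r * (1 / 2)) (u i) x - moll r (u i) x)
        = (fun x => moll (r * (1 / 2)) (u i) x - u i x) - (fun x => moll r (u i) x - u i x) := by
      ext x; simp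
    rw [h3]
    have m1 := ((contDiff_moll hr2 (hul i)).continuous.sub (hu i).continuous).aestronglyMeasurable
      (μ := (volume : Measure (Euc n)))
    have m2 := ((contDiff_moll hr (hul i)).continuous.sub (hu i).continuous).aestronglyMeasurable
      (μ := (volume : Measure (Euc n)))
    refine (eLpNorm_sub_le m1 m2 (by exact_mod_cast hn)).trans ((add_le_add h1 h2).trans ?_)
    rw [hinv]
    calc _ ≤ (M : ℝ≥0∞) * (2 * R⁻¹ * X i) + M * (R⁻¹ * X i) := by gcongr; exact hX2 i
      _ = 3 * (M * (R⁻¹ * X i)) := by ring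
      _ ≤ 4 * (M * (R⁻¹ * X i)) := by gcongr; norm_num
      _ = (R⁻¹ * R) * (4 * M * (R⁻¹ * X i)) := by
          rw [ENNReal.inv_mul_cancel hR hR']; ring
      _ = _ := by ring

end Scales

/-! ### The Jacobian estimate for smooth compactly supported tuples. -/

section SmoothEstimate

variable {n : ℕ}

lemma tendsto_of_enorm_sub_le {l : Filter ℝ} {f : ℝ → ℝ} {a : ℝ} {b : ℝ → ℝ≥0∞}
    (h : ∀ᶠ r in l, ‖f r - a‖ₑ ≤ b r) (hb : Tendsto b l (𝓝 0)) : Tendsto f l (𝓝 a) := by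
  rw [tendsto_iff_edist_tendsto_0]
  simp_rw [edist_eq_enorm_sub]
  exact tendsto_of_tendsto_of_tendsto_of_le_of_le' tendsto_const_nhds hb
    (Eventually.of_forall fun _ => zero_le) h

/-- Stability between `u` and its mollification. As `u` is Lipschitz with compact support, the
bounds `B` on the gradients do not depend on `r ≤ 1`, and only the factor `r^α` from `φ` remains. -/
lemma exists_enorm_mollPairing_sub_le (hn : 1 ≤ n) {α : ℝ≥0} {u : Fin n → Euc n → ℝ}
    (hu : ∀ i, ContDiff ℝ ∞ (u i)) (huc : ∀ i, HasCompactSupport (u i)) {φ : Euc n → ℝ}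
    {H : ℝ≥0} (hφc : Continuous φ) (hφ : HolderWith H α φ) :
    ∃ K : ℝ≥0∞, K ≠ ⊤ ∧ ∀ r : ℝ, 0 < r → r ≤ 1 →
      ‖mollPairing u φ r - ∫ x, jac u x * φ x‖ₑ ≤ K * ENNReal.ofReal r ^ (α : ℝ) := by
  obtain ⟨M, hM⟩ := exists_eLpNorm_moll_bound n hn ℝ
  obtain ⟨M', hM'⟩ := exists_moll_holder_bound n
  have hn0 : (n : ℝ) ≠ 0 := by positivity
  have hul : ∀ i, LocallyIntegrable (u i) := fun i => (hu i).continuous.locallyIntegrable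
  have hum : ∀ i, Measurable (u i) := fun i => (hu i).continuous.measurable
  have hlip : ∀ i, ∃ C : ℝ≥0∞, C ≠ ⊤ ∧ ∀ r : ℝ, 0 < r → r ≤ 1 →
      osc n r (u i) ≤ C * (ENNReal.ofReal r ^ (n : ℝ) * ENNReal.ofReal r ^ n) := by
    intro i
    obtain ⟨K, hK⟩ := ContDiff.lipschitzWith_of_hasCompactSupport (huc i) (hu i) (by simp)
    exact exists_osc_le_of_lipschitz hK (huc i) (by positivity)
  choose Q hQ hQosc using hlip
  set D : Fin n → ℝ≥0∞ := fun i => eLpNorm (fderiv ℝ (u i)) n volume with hD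
  have hDtop : ∀ i, D i ≠ ⊤ := fun i =>
    (((hu i).continuous_fderiv (by simp)).memLp_of_hasCompactSupport ((huc i).fderiv ℝ)).eLpNorm_ne_top
  set B : Fin n → ℝ≥0∞ := fun i => D i + M * Q i ^ (1 / (n : ℝ)) with hB
  have hBtop : ∀ i, B i ≠ ⊤ := fun i => ENNReal.add_ne_top.2 ⟨hDtop i,
    ENNReal.mul_ne_top (by simp) (ENNReal.rpow_ne_top_of_nonneg (by positivity) (hQ i))⟩
  refine ⟨n.factorial * (M' * H + n * (M' * H)) * ∏ i, B i,
    ENNReal.mul_ne_top (ENNReal.mul_ne_top (by simp) ?_) (ENNReal.prod_ne_top fun i _ => hBtop i),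
    fun r hr hr1 => ?_⟩
  · exact_mod_cast ENNReal.coe_ne_top (r := M' * H + n * (M' * H))
  set R := ENNReal.ofReal r with hRdef
  have hR : R ≠ 0 := by simpa [hRdef] using hr
  have hR' : R ≠ ⊤ := by simp [hRdef]
  have hX : ∀ i, R⁻¹ * (R⁻¹ * osc n r (u i) ^ (1 / (n : ℝ))) ≤ Q i ^ (1 / (n : ℝ)) := by
    intro i
    have h1 : osc n r (u i) ^ (1 / (n : ℝ)) ≤ Q i ^ (1 / (n : ℝ)) * (R * R) := by
      refine (ENNReal.rpow_le_rpow (hQosc i r hr hr1) (by positivity)).trans_eq ?_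
      rw [← ENNReal.rpow_natCast, ENNReal.mul_rpow_of_nonneg _ _ (by positivity),
        ENNReal.mul_rpow_of_nonneg _ _ (by positivity), ← ENNReal.rpow_mul,
        mul_one_div_cancel hn0, ENNReal.rpow_one]
    calc _ ≤ R⁻¹ * (R⁻¹ * (Q i ^ (1 / (n : ℝ)) * (R * R))) := by gcongr
      _ = (R⁻¹ * R) * (R⁻¹ * R) * Q i ^ (1 / (n : ℝ)) := by ring
      _ = _ := by rw [ENNReal.inv_mul_cancel hR hR', one_mul, one_mul]
  have key := enorm_integral_jac_mul_sub_le hn (f := u) (g := fun i => moll r (u i)) hu huc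
    (fun i => contDiff_moll hr (hul i)) (fun i => hasCompactSupport_moll hr (huc i))
    (f₀ := φ) (g₀ := moll r φ) hφc (contDiff_moll hr hφc.locallyIntegrable)
    (m := M' * (H * R ^ (α : ℝ))) (L := M' * (R⁻¹ * (H * R ^ (α : ℝ)))) (r := R) (B := B)
    (fun x => (hM' r hr α H φ hφc hφ x).1) (fun x => (hM' r hr α H φ hφc hφ x).2)
    (fun i => le_self_add) ?_ ?_
  · rw [← enorm_neg, neg_sub]
    refine key.trans_eq ?_
    have e1 : M' * (R⁻¹ * (H * R ^ (α : ℝ))) * R = M' * (H * R ^ (α : ℝ)) := by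
      calc _ = M' * ((R⁻¹ * R) * (H * R ^ (α : ℝ))) := by ring
        _ = _ := by rw [ENNReal.inv_mul_cancel hR hR', one_mul]
    rw [e1]
    ring
  · intro i
    refine (hM _ hr (u i) (hul i) (hum i)).2.trans (le_trans ?_ le_add_self)
    gcongr
    exact hX i
  · intro i
    have h3 : eLpNorm (fun x => u i x - moll r (u i) x) n volume
        = eLpNorm (fun x => moll r (u i) x - u i x) n volume := eLpNorm_sub_comm _ _ _ _
    rw [h3]
    refine (hM _ hr (u i) (hul i) (hum i)).1.trans ?_
    calc _ = (R⁻¹ * R) * (M * (R⁻¹ * osc n r (u i) ^ (1 / (n : ℝ)))) := by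
          rw [ENNReal.inv_mul_cancel hR hR', one_mul]
      _ = R * (M * (R⁻¹ * (R⁻¹ * osc n r (u i) ^ (1 / (n : ℝ))))) := by ring
      _ ≤ R * (M * Q i ^ (1 / (n : ℝ))) := by gcongr; exact hX i
      _ ≤ _ := by gcongr; exact le_add_self

lemma tendsto_mollPairing_zero (hn : 1 ≤ n) {α : ℝ≥0} (hα : 0 < α) {u : Fin n → Euc n → ℝ}
    (hu : ∀ i, ContDiff ℝ ∞ (u i)) (huc : ∀ i, HasCompactSupport (u i)) {φ : Euc n → ℝ}
    {H : ℝ≥0} (hφc : Continuous φ) (hφ : HolderWith H α φ) :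
    Tendsto (mollPairing u φ) (𝓝[>] 0) (𝓝 (∫ x, jac u x * φ x)) := by
  obtain ⟨K, hK, h⟩ := exists_enorm_mollPairing_sub_le hn hu huc hφc hφ
  refine tendsto_of_enorm_sub_le (b := fun r => K * ENNReal.ofReal r ^ (α : ℝ)) ?_ ?_
  · filter_upwards [Ioc_mem_nhdsGT (zero_lt_one' ℝ)] with r hr using h r hr.1 hr.2
  · have h1 : Continuous fun r : ℝ => ENNReal.ofReal r ^ (α : ℝ) :=
      (ENNReal.continuous_rpow_const).comp ENNReal.continuous_ofReal
    have h2 := ENNReal.Tendsto.const_mul ((h1.tendsto 0).mono_left nhdsWithin_le_nhds) (Or.inr hK)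
      (b := (ENNReal.ofReal 0 ^ (α : ℝ)))  (f := 𝓝[>] (0 : ℝ))
    simpa [hα] using h2

lemma jac_zero (hn : 1 ≤ n) (x : Euc n) : jac (fun _ => fun _ : Euc n => (0 : ℝ)) x = 0 :=
  jac_eq_zero (j := (⟨0, hn⟩ : Fin n)) (by simp [tsupport, Function.support])

/-- Stability between the mollified tuple and zero. Young's inequality bounds the functions in `Lⁿ`
uniformly in `r`, each gradient gains `r⁻¹`, and the test function contributes `r^α` in all. -/
lemma exists_enorm_mollPairing_le (hn : 1 ≤ n) {α : ℝ≥0} {u : Fin n → Euc n → ℝ}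
    (hu : ∀ i, ContDiff ℝ ∞ (u i)) (huc : ∀ i, HasCompactSupport (u i)) {φ : Euc n → ℝ}
    {H : ℝ≥0} (hφc : Continuous φ) (hφ : HolderWith H α φ) :
    ∃ K : ℝ≥0∞, K ≠ ⊤ ∧ ∀ r : ℝ, 0 < r →
      ‖mollPairing u φ r‖ₑ ≤ K * ENNReal.ofReal r ^ ((α : ℝ) - n) := by
  obtain ⟨M, hM⟩ := exists_eLpNorm_moll_bound n hn ℝ
  obtain ⟨M', hM'⟩ := exists_moll_holder_bound n
  have hn0 : (n : ℝ) ≠ 0 := by positivity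
  have hn1 : (1 : ℝ) ≤ n := by exact_mod_cast hn
  have hul : ∀ i, LocallyIntegrable (u i) := fun i => (hu i).continuous.locallyIntegrable
  have hum : ∀ i, Measurable (u i) := fun i => (hu i).continuous.measurable
  set D : Fin n → ℝ≥0∞ := fun i => eLpNorm (u i) n volume with hD
  have hDtop : ∀ i, D i ≠ ⊤ := fun i =>
    ((hu i).continuous.memLp_of_hasCompactSupport (huc i)).eLpNorm_ne_top
  set c : ℝ≥0∞ := 2 * volume (Metric.ball (0 : Euc n) 1) ^ (1 / (n : ℝ)) with hc
  have hctop : c ≠ ⊤ := ENNReal.mul_ne_top (by simp)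
    (ENNReal.rpow_ne_top_of_nonneg (by positivity) measure_ball_lt_top.ne)
  set A : Fin n → ℝ≥0∞ := fun i => D i + M * (c * D i) with hA
  have hAtop : ∀ i, A i ≠ ⊤ := fun i => ENNReal.add_ne_top.2 ⟨hDtop i,
    ENNReal.mul_ne_top (by simp) (ENNReal.mul_ne_top hctop (hDtop i))⟩
  refine ⟨n.factorial * (n * (M' * H)) * ∏ i, A i,
    ENNReal.mul_ne_top (ENNReal.mul_ne_top (by simp) ?_) (ENNReal.prod_ne_top fun i _ => hAtop i),
    fun r hr => ?_⟩
  · exact_mod_cast ENNReal.coe_ne_top (r := n * (M' * H))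
  set R := ENNReal.ofReal r with hRdef
  have hR : R ≠ 0 := by simpa [hRdef] using hr
  have hR' : R ≠ ⊤ := by simp [hRdef]
  have hX : ∀ i, R⁻¹ * osc n r (u i) ^ (1 / (n : ℝ)) ≤ c * D i := by
    intro i
    have h1 : osc n r (u i) ^ (1 / (n : ℝ)) ≤ R * (c * D i) := by
      refine (ENNReal.rpow_le_rpow (osc_le hn1 (hum i) hr) (by positivity)).trans_eq ?_
      simp only [hD, eLpNorm_natCast_eq hn, hc]
      rw [← ENNReal.rpow_natCast, ENNReal.mul_rpow_of_nonneg _ _ (by positivity),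
        ENNReal.mul_rpow_of_nonneg _ _ (by positivity),
        ENNReal.mul_rpow_of_nonneg _ _ (by positivity), ← ENNReal.rpow_mul, ← ENNReal.rpow_mul,
        mul_one_div_cancel hn0, ENNReal.rpow_one, ENNReal.rpow_one]
      ring
    calc _ ≤ R⁻¹ * (R * (c * D i)) := by gcongr
      _ = _ := by rw [← mul_assoc, ENNReal.inv_mul_cancel hR hR', one_mul]
  have key := enorm_integral_jac_mul_sub_le hn (f := fun i => moll r (u i)) (g := fun _ _ => 0)
    (fun i => contDiff_moll hr (hul i)) (fun i => hasCompactSupport_moll hr (huc i))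
    (fun _ => contDiff_const) (fun _ => HasCompactSupport.zero)
    (f₀ := moll r φ) (g₀ := moll r φ) (contDiff_moll hr hφc.locallyIntegrable).continuous
    (contDiff_moll hr hφc.locallyIntegrable)
    (m := 0) (L := M' * (R⁻¹ * (H * R ^ (α : ℝ)))) (r := R) (B := fun i => R⁻¹ * A i)
    (fun x => by simp) (fun x => (hM' r hr α H φ hφc hφ x).2) ?_ ?_ ?_
  · simp only [jac_zero hn, zero_mul, integral_zero, sub_zero] at key
    refine key.trans_eq ?_
    have e1 : M' * (R⁻¹ * (H * R ^ (α : ℝ))) * R = M' * (H * R ^ (α : ℝ)) := by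
      calc _ = M' * ((R⁻¹ * R) * (H * R ^ (α : ℝ))) := by ring
        _ = _ := by rw [ENNReal.inv_mul_cancel hR hR', one_mul]
    rw [e1, Finset.prod_mul_distrib, Finset.prod_const, Finset.card_univ, Fintype.card_fin,
      sub_eq_add_neg, ENNReal.rpow_add _ _ hR hR', ENNReal.rpow_neg, ENNReal.rpow_natCast,
      ENNReal.inv_pow]
    ring
  · intro i
    refine (hM _ hr (u i) (hul i) (hum i)).2.trans ?_
    calc _ ≤ (M : ℝ≥0∞) * (R⁻¹ * (c * D i)) :=
          mul_le_mul_right (mul_le_mul_right (hX i) _) _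
      _ = R⁻¹ * (M * (c * D i)) := by ring
      _ ≤ _ := by gcongr; exact le_add_self
  · intro i
    have h0 : ∀ x, ‖fderiv ℝ (fun _ : Euc n => (0 : ℝ)) x‖ₑ = 0 := fun x => by
      rw [← ofReal_norm]; simp
    rw [eLpNorm_natCast_eq hn]
    simp only [h0, ENNReal.zero_rpow_of_pos (by positivity : (0 : ℝ) < n), lintegral_zero,
      ENNReal.zero_rpow_of_pos (by positivity : 0 < 1 / (n : ℝ)), zero_le]
  · intro i
    have e1 : R * (R⁻¹ * A i) = A i := by
      rw [← mul_assoc, ENNReal.mul_inv_cancel hR hR', one_mul]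
    simp only [sub_zero]
    rw [e1]
    have e2 : eLpNorm (moll r (u i)) n volume ≤ D i := by
      simp only [hD, eLpNorm_natCast_eq hn]
      gcongr ?_ ^ _
      exact lintegral_moll_rpow_le hn1 hr (hum i)
    exact e2.trans le_self_add

lemma tendsto_mollPairing_atTop (hn : 1 ≤ n) {α : ℝ≥0} (hα : (α : ℝ) < n) {u : Fin n → Euc n → ℝ}
    (hu : ∀ i, ContDiff ℝ ∞ (u i)) (huc : ∀ i, HasCompactSupport (u i)) {φ : Euc n → ℝ}
    {H : ℝ≥0} (hφc : Continuous φ) (hφ : HolderWith H α φ) :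
    Tendsto (mollPairing u φ) atTop (𝓝 0) := by
  obtain ⟨K, hK, h⟩ := exists_enorm_mollPairing_le hn hu huc hφc hφ
  refine tendsto_of_enorm_sub_le (b := fun r => K * ENNReal.ofReal r ^ ((α : ℝ) - n)) ?_ ?_
  · filter_upwards [eventually_gt_atTop 0] with r hr
    simpa using h r hr
  · have h1 : Tendsto (fun r : ℝ => ENNReal.ofReal r ^ ((α : ℝ) - n)) atTop (𝓝 0) := by
      have h2 := (ENNReal.continuous_rpow_const (y := (α : ℝ) - n)).tendsto ⊤
      rw [ENNReal.top_rpow_of_neg (by linarith)] at h2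
      exact h2.comp ENNReal.tendsto_ofReal_atTop
    simpa using ENNReal.Tendsto.const_mul h1 (Or.inr hK)

/-- The increments between dyadic scales are summed with a bound independent of the largest scale
and of the number of steps. -/
lemma exists_jac_bound_of_pos (hn : 1 ≤ n) {α : ℝ≥0} {β : ℝ} (hα : 0 < α) (hβ : 0 < β)
    (hαβ : (α : ℝ) / n = 1 - β) :
    ∃ C : ℝ≥0, ∀ (u : Fin n → Euc n → ℝ), (∀ i, ContDiff ℝ ∞ (u i)) →
      (∀ i, HasCompactSupport (u i)) → ∀ (φ : Euc n → ℝ) (H : ℝ≥0), Continuous φ →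
      HolderWith H α φ →
      ‖∫ x, jac u x * φ x‖ₑ ≤ C * H * ∏ i, gagliardoSeminorm β n (u i) := by
  have hn0 : (0 : ℝ) < n := by positivity
  obtain ⟨C₁, h1⟩ := exists_mollPairing_step hn hαβ
  obtain ⟨C₂, h2⟩ := exists_sum_osc_le (n := n) (F := ℝ) (s := (n : ℝ) + β * n) (p := n)
    (by positivity) hn0
  refine ⟨C₁ * C₂, fun u hu huc φ H hφc hφ => ?_⟩
  have hum : ∀ i, Measurable (u i) := fun i => (hu i).continuous.measurable
  -- Positivity of `β` gives `α = n(1-β) < n`, hence decay at large scales.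
  have hαn : (α : ℝ) < n := by
    rw [div_eq_iff hn0.ne'] at hαβ
    nlinarith
  have step : ∀ R : ℝ, 0 < R → ∀ N : ℕ,
      ‖mollPairing u φ (R * (1 / 2) ^ N) - mollPairing u φ R‖ₑ
        ≤ (C₁ * C₂ : ℝ≥0) * H * ∏ i, gagliardoSeminorm β n (u i) := by
    intro R hR N
    have e1 : mollPairing u φ (R * (1 / 2) ^ N) - mollPairing u φ R
        = ∑ j ∈ Finset.range N, (mollPairing u φ (R * (1 / 2) ^ (j + 1))
          - mollPairing u φ (R * (1 / 2) ^ j)) := by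
      rw [Finset.sum_range_sub (fun j => mollPairing u φ (R * (1 / 2) ^ j))]
      simp
    rw [e1]
    calc _ ≤ ∑ j ∈ Finset.range N, ‖mollPairing u φ (R * (1 / 2) ^ (j + 1))
          - mollPairing u φ (R * (1 / 2) ^ j)‖ₑ := enorm_sum_le _ _
      _ ≤ ∑ j ∈ Finset.range N, C₁ * H * ∏ i, (ENNReal.ofReal (R * (1 / 2) ^ j) ^
            (-((n : ℝ) + β * n)) * osc n (R * (1 / 2) ^ j) (u i)) ^ (1 / (n : ℝ)) := by
          refine Finset.sum_le_sum fun j _ => ?_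
          rw [pow_succ, ← mul_assoc]
          exact h1 u hu huc φ H hφc hφ _ (by positivity)
      _ ≤ C₁ * H * ∏ i, (∑ j ∈ Finset.range N, ENNReal.ofReal (R * (1 / 2) ^ j) ^
            (-((n : ℝ) + β * n)) * osc n (R * (1 / 2) ^ j) (u i)) ^ (1 / (n : ℝ)) := by
          rw [← Finset.mul_sum]
          gcongr
          exact sum_prod_rpow_le hn N fun i j => ENNReal.ofReal (R * (1 / 2) ^ j) ^
            (-((n : ℝ) + β * n)) * osc n (R * (1 / 2) ^ j) (u i)
      _ ≤ C₁ * H * ∏ i, ((C₂ : ℝ≥0∞) ^ (1 / (n : ℝ)) * gagliardoSeminorm β n (u i)) := by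
          gcongr with i
          rw [gagliardoSeminorm_eq_shiftEnergy β n (hum i),
            ← ENNReal.mul_rpow_of_nonneg _ _ (by positivity)]
          gcongr
          exact h2 R hR N (u i) (hum i)
      _ = _ := by
          rw [Finset.prod_mul_distrib, Finset.prod_const, Finset.card_univ, Fintype.card_fin,
            ← ENNReal.rpow_natCast, ← ENNReal.rpow_mul, one_div_mul_cancel hn0.ne',
            ENNReal.rpow_one]
          push_cast
          ring
  -- The smallest scale is sent to zero with `R` fixed; afterwards `R → ∞` removes the pairing at
  -- scale `R`.
  have lim1 : ∀ R : ℝ, 0 < R → ‖(∫ x, jac u x * φ x) - mollPairing u φ R‖ₑ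
      ≤ (C₁ * C₂ : ℝ≥0) * H * ∏ i, gagliardoSeminorm β n (u i) := by
    intro R hR
    have t1 : Tendsto (fun N : ℕ => R * (1 / 2 : ℝ) ^ N) atTop (𝓝[>] 0) := by
      refine tendsto_nhdsWithin_iff.2 ⟨?_, Eventually.of_forall fun N => ?_⟩
      · simpa using (tendsto_pow_atTop_nhds_zero_of_lt_one (r := (1 / 2 : ℝ)) (by norm_num)
          (by norm_num)).const_mul R
      · exact Set.mem_Ioi.2 (by positivity)
    have t2 := (((tendsto_mollPairing_zero hn hα hu huc hφc hφ).comp t1).sub_const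
      (mollPairing u φ R)).enorm
    exact le_of_tendsto t2 (Eventually.of_forall fun N => step R hR N)
  have t3 := ((tendsto_mollPairing_atTop hn hαn hu huc hφc hφ).const_sub
    (∫ x, jac u x * φ x)).enorm
  rw [sub_zero] at t3
  exact le_of_tendsto t3 ((eventually_gt_atTop 0).mono lim1)

/-- In dimension one and for Lipschitz `φ` the pairing is controlled by the `L¹` norm. -/
lemma exists_jac_bound_of_lipschitz :
    ∃ C : ℝ≥0, ∀ (u : Fin 1 → Euc 1 → ℝ), (∀ i, ContDiff ℝ ∞ (u i)) →
      (∀ i, HasCompactSupport (u i)) → ∀ (φ : Euc 1 → ℝ) (H : ℝ≥0), Continuous φ →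
      HolderWith H 1 φ →
      ‖∫ x, jac u x * φ x‖ₑ ≤ C * H * eLpNorm (u 0) 1 volume := by
  obtain ⟨M', hM'⟩ := exists_moll_holder_bound 1
  refine ⟨M', fun u hu huc φ H hφc hφ => ?_⟩
  have hDtop : eLpNorm (fderiv ℝ (u 0)) 1 volume ≠ ⊤ :=
    (((hu 0).continuous_fderiv (by simp)).memLp_of_hasCompactSupport ((huc 0).fderiv ℝ)).eLpNorm_ne_top
  have bound : ∀ r : ℝ, 0 < r → ‖∫ x, jac u x * moll r φ x‖ₑ
      ≤ M' * H * eLpNorm (u 0) 1 volume := by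
    intro r hr
    have h := enorm_integral_jac_mul_le_of_fderiv le_rfl hu 0 (huc 0)
      (contDiff_moll hr hφc.locallyIntegrable) (fun x => (hM' r hr 1 H φ hφc hφ x).2)
    refine h.trans_eq ?_
    -- For `α = 1` the gradient bound of the mollified test function does not depend on `r`.
    have e : (ENNReal.ofReal r)⁻¹ * (H * ENNReal.ofReal r ^ ((1 : ℝ≥0) : ℝ)) = H := by
      rw [NNReal.coe_one, ENNReal.rpow_one, mul_left_comm,
        ENNReal.inv_mul_cancel (by simpa using hr) (by simp), mul_one]
    rw [e]
    simp
  have lim : Tendsto (fun r => ∫ x, jac u x * moll r φ x) (𝓝[>] 0) (𝓝 (∫ x, jac u x * φ x)) := by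
    refine tendsto_of_enorm_sub_le
      (b := fun r => M' * H * eLpNorm (fderiv ℝ (u 0)) 1 volume * ENNReal.ofReal r) ?_ ?_
    · filter_upwards [self_mem_nhdsWithin] with r (hr : 0 < r)
      have h := enorm_integral_jac_mul_le le_rfl hu (f₀ := fun x => φ x - moll r φ x)
        (fun x => (hM' r hr 1 H φ hφc hφ x).1)
      have e : (∫ x, jac u x * moll r φ x) - ∫ x, jac u x * φ x
          = - ∫ x, jac u x * (φ x - moll r φ x) := by
        simp_rw [mul_sub]
        rw [integral_sub (integrable_jac_mul le_rfl hu huc hφc) (integrable_jac_mul le_rfl hu huc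
          (contDiff_moll hr hφc.locallyIntegrable).continuous)]
        ring
      rw [e, enorm_neg]
      refine h.trans_eq ?_
      simp
      ring
    · have h1 := (ENNReal.continuous_ofReal.tendsto 0).mono_left
        (nhdsWithin_le_nhds (s := Set.Ioi (0 : ℝ)))
      simpa using ENNReal.Tendsto.const_mul h1 (Or.inr (ENNReal.mul_ne_top
        (ENNReal.mul_ne_top ENNReal.coe_ne_top ENNReal.coe_ne_top) hDtop))
  exact le_of_tendsto lim.enorm (by
    filter_upwards [self_mem_nhdsWithin] with r hr using bound r hr)

/-- The Jacobian estimate for smooth compactly supported functions. -/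
lemma exists_jac_bound (hn : 1 ≤ n) {α : ℝ≥0} {β : ℝ} (hβ : β ∈ Set.Ico (((n : ℝ) - 1) / n) 1)
    (hα : α ∈ Set.Ioc (0 : ℝ≥0) 1) (hαβ : (α : ℝ) / n = 1 - β) :
    ∃ C : ℝ≥0, ∀ (u : Fin n → Euc n → ℝ), (∀ i, ContDiff ℝ ∞ (u i)) →
      (∀ i, HasCompactSupport (u i)) → ∀ (φ : Euc n → ℝ) (H : ℝ≥0), Continuous φ →
      HolderWith H α φ →
      ‖∫ x, jac u x * φ x‖ₑ ≤ C * H * ∏ i, fracSeminorm β n (u i) := by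
  have hn0 : (0 : ℝ) < n := by positivity
  have hn1 : (1 : ℝ) ≤ n := by exact_mod_cast hn
  by_cases hβ0 : β = 0
  -- Here `α = n`, and `α ≤ 1` forces `n = 1` and `α = 1`.
  · subst hβ0
    rw [sub_zero, div_eq_one_iff_eq hn0.ne'] at hαβ
    have hα1 : (α : ℝ) ≤ 1 := by exact_mod_cast hα.2
    have hn' : n = 1 := by
      have : (n : ℝ) ≤ 1 := by linarith
      have : n ≤ 1 := by exact_mod_cast this
      omega
    subst hn'
    have hα' : α = 1 := by
      rw [← NNReal.coe_inj]; simpa using hαβ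
    subst hα'
    obtain ⟨C, hC⟩ := exists_jac_bound_of_lipschitz
    refine ⟨C, fun u hu huc φ H hφc hφ => ?_⟩
    simpa [fracSeminorm] using hC u hu huc φ H hφc hφ
  · have hβ' : 0 < β := lt_of_le_of_ne ((div_nonneg (by linarith) hn0.le).trans hβ.1) (Ne.symm hβ0)
    simpa only [fracSeminorm, if_neg hβ0] using exists_jac_bound_of_pos hn hα.1 hβ' hαβ

end SmoothEstimate

/-! ### Properties of the seminorm and density of smooth compactly supported functions. -/

section Density

variable {n : ℕ}

section Seminorm

variable {F : Type*} [NormedAddCommGroup F]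

lemma gagliardoSeminorm_congr_ae {β p : ℝ} {f g : Euc n → F} (h : f =ᵐ[volume] g) :
    gagliardoSeminorm β p f = gagliardoSeminorm β p g := by
  unfold gagliardoSeminorm
  congr 1
  refine lintegral_congr_ae ?_
  filter_upwards [h] with x hx
  refine lintegral_congr_ae ?_
  filter_upwards [h] with y hy
  rw [hx, hy]

lemma fracSeminorm_congr_ae {β p : ℝ} {f g : Euc n → F} (h : f =ᵐ[volume] g) :
    fracSeminorm β p f = fracSeminorm β p g := by
  unfold fracSeminorm
  rw [eLpNorm_congr_ae h, gagliardoSeminorm_congr_ae h]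

lemma gagliardoSeminorm_add_le {β p : ℝ} (hp : 1 ≤ p) {f g : Euc n → F}
    (hf : AEStronglyMeasurable f) (hg : AEStronglyMeasurable g) :
    gagliardoSeminorm β p (fun x => f x + g x)
      ≤ gagliardoSeminorm β p f + gagliardoSeminorm β p g := by
  set s : ℝ := (n : ℝ) + β * p with hs
  have hp0 : 0 < p := by linarith
  -- The seminorm is the `Lᵖ` norm of this difference quotient on the product space, so Minkowski's
  -- inequality applies.
  set Q : (Euc n → F) → Euc n × Euc n → ℝ≥0∞ :=
    fun f z => ‖f z.1 - f z.2‖ₑ / ‖z.1 - z.2‖ₑ ^ (s / p) with hQ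
  have hQm : ∀ f : Euc n → F, AEStronglyMeasurable f → AEMeasurable (Q f) := fun f hf =>
    AEMeasurable.div (hf.comp_fst.sub hf.comp_snd).enorm
      ((measurable_fst.sub measurable_snd).enorm.pow_const _).aemeasurable
  have hQp : ∀ (a b : ℝ≥0∞), (a / b ^ (s / p)) ^ p = a ^ p / b ^ s := fun a b => by
    rw [ENNReal.div_rpow_of_nonneg _ _ hp0.le, ← ENNReal.rpow_mul, div_mul_cancel₀ _ hp0.ne']
  have hQe : ∀ f : Euc n → F, AEStronglyMeasurable f →
      gagliardoSeminorm β p f = (∫⁻ z, Q f z ^ p) ^ (1 / p) := fun f hf => by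
    rw [Measure.volume_eq_prod, lintegral_prod _ ((hQm f hf).pow_const p)]
    simp only [hQ, hQp]
    rfl
  rw [hQe (fun x => f x + g x) (hf.add hg), hQe _ hf, hQe _ hg]
  refine le_trans ?_ (ENNReal.lintegral_Lp_add_le (hQm f hf) (hQm g hg) hp)
  gcongr with z
  simp only [hQ, Pi.add_apply]
  rw [← ENNReal.add_div]
  gcongr
  rw [add_sub_add_comm]
  exact enorm_add_le _ _

lemma fracSeminorm_add_le {β p : ℝ} (hp : 1 ≤ p) {f g : Euc n → F}
    (hf : AEStronglyMeasurable f) (hg : AEStronglyMeasurable g) :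
    fracSeminorm β p (fun x => f x + g x) ≤ fracSeminorm β p f + fracSeminorm β p g := by
  unfold fracSeminorm
  split_ifs
  · exact eLpNorm_add_le hf hg (by simpa using hp)
  · exact gagliardoSeminorm_add_le hp hf hg

lemma fracSeminorm_mono {G : Type*} [NormedAddCommGroup G] {β p : ℝ} (hp : 0 < p) {f : Euc n → F}
    {g : Euc n → G} (h : ∀ x, ‖f x‖ₑ ≤ ‖g x‖ₑ) (h' : ∀ x y, ‖f x - f y‖ₑ ≤ ‖g x - g y‖ₑ) :
    fracSeminorm β p f ≤ fracSeminorm β p g := by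
  unfold fracSeminorm gagliardoSeminorm
  split_ifs
  · exact eLpNorm_mono_enorm h
  · gcongr
    exact h' _ _

lemma fracSeminorm_sub_comm {β p : ℝ} (hp : 0 < p) (f g : Euc n → F) :
    fracSeminorm β p (fun x => f x - g x) = fracSeminorm β p (fun x => g x - f x) := by
  have : ∀ f g : Euc n → F, fracSeminorm β p (fun x => f x - g x)
      ≤ fracSeminorm β p (fun x => g x - f x) := fun f g =>
    fracSeminorm_mono hp (fun x => by rw [← enorm_neg, neg_sub])
      fun x y => by
        have e : f x - g x - (f y - g y) = -(g x - f x - (g y - f y)) := by abel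
        rw [e, enorm_neg]
  exact le_antisymm (this f g) (this g f)

/-- Dominated convergence in the shift variable: for each `t` the shift energy is controlled by the
`Lᵖ` norm, which tends to zero. -/
lemma tendsto_gagliardoSeminorm_zero [MeasurableSpace F] [BorelSpace F]
    [SecondCountableTopology F] {β p : ℝ} (hp : 1 ≤ p) {w : ℕ → Euc n → F}
    (hw : ∀ k, Measurable (w k)) (hw0 : Tendsto (fun k => ∫⁻ x, ‖w k x‖ₑ ^ p) atTop (𝓝 0))
    {G : Euc n → ℝ≥0∞} (hG : ∀ k t, shiftEnergy p (w k) t ≤ G t)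
    (hGi : ∫⁻ t, G t / ‖t‖ₑ ^ ((n : ℝ) + β * p) ≠ ⊤) :
    Tendsto (fun k => gagliardoSeminorm β p (w k)) atTop (𝓝 0) := by
  have hp0 : 0 < p := by linarith
  set s : ℝ := (n : ℝ) + β * p with hs
  have h1 : Tendsto (fun k => ∫⁻ t, shiftEnergy p (w k) t / ‖t‖ₑ ^ s) atTop
      (𝓝 (∫⁻ _ : Euc n, 0)) := by
    refine tendsto_lintegral_of_dominated_convergence (fun t => G t / ‖t‖ₑ ^ s)
      (fun k => (measurable_shiftEnergy p (hw k)).div (measurable_enorm.pow_const _))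
      (fun k => Eventually.of_forall fun t => ENNReal.div_le_div_right (hG k t) _) hGi
      (Eventually.of_forall fun t => ?_)
    by_cases ht : t = 0
    · subst ht; simp [shiftEnergy_zero hp0]
    · have h2 : Tendsto (fun k => 2 ^ p * ∫⁻ x, ‖w k x‖ₑ ^ p) atTop (𝓝 0) := by
        simpa using ENNReal.Tendsto.const_mul hw0
          (Or.inr (ENNReal.rpow_ne_top_of_nonneg hp0.le (by simp : (2 : ℝ≥0∞) ≠ ⊤)))
      have h3 : Tendsto (fun k => shiftEnergy p (w k) t) atTop (𝓝 0) :=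
        tendsto_of_tendsto_of_tendsto_of_le_of_le tendsto_const_nhds h2 (fun _ => zero_le)
          fun k => shiftEnergy_le hp (hw k) t
      have h4 : (‖t‖ₑ ^ s)⁻¹ ≠ ⊤ := by
        rw [ENNReal.inv_ne_top]
        simp [ENNReal.rpow_eq_zero_iff, ht]
      simpa [div_eq_mul_inv] using ENNReal.Tendsto.mul_const h3 (Or.inr h4)
  simp_rw [fun k => gagliardoSeminorm_eq_shiftEnergy β p (hw k)]
  have h5 := (ENNReal.continuous_rpow_const (y := 1 / p)).tendsto 0
  rw [ENNReal.zero_rpow_of_pos (by positivity)] at h5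
  rw [lintegral_zero] at h1
  exact h5.comp h1

/-- On the ball of radius `r` the weight `‖t‖^(-s)` is at least `r^(-s)`. -/
lemma osc_le_gagliardo {p s r : ℝ} (hp : 0 < p) (hs : 0 < s) (u : Euc n → F) :
    osc p r u ≤ ENNReal.ofReal r ^ s * ∫⁻ t, shiftEnergy p u t / ‖t‖ₑ ^ s := by
  rw [osc, ← lintegral_const_mul' _ _ (ENNReal.rpow_ne_top_of_nonneg hs.le ENNReal.ofReal_ne_top),
    ← lintegral_indicator Metric.isClosed_closedBall.measurableSet]
  refine lintegral_mono fun t => ?_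
  by_cases ht : t ∈ Metric.closedBall (0 : Euc n) r
  · rw [Set.indicator_of_mem ht]
    by_cases h0 : t = 0
    · subst h0; simp [shiftEnergy_zero hp]
    have h1 : ‖t‖ₑ ^ s ≤ ENNReal.ofReal r ^ s := by
      gcongr
      rw [← ofReal_norm]
      exact ENNReal.ofReal_le_ofReal (mem_closedBall_zero_iff.1 ht)
    have h2 : ‖t‖ₑ ^ s ≠ 0 := by simp [ENNReal.rpow_eq_zero_iff, h0]
    have h3 : ‖t‖ₑ ^ s ≠ ⊤ := ENNReal.rpow_ne_top_of_nonneg hs.le (by simp)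
    calc shiftEnergy p u t = ‖t‖ₑ ^ s * (shiftEnergy p u t / ‖t‖ₑ ^ s) :=
          (ENNReal.mul_div_cancel h2 h3).symm
      _ ≤ _ := by gcongr
  · rw [Set.indicator_of_notMem ht]
    exact zero_le

end Seminorm

lemma enorm_euc_apply_le (v : Euc n) (i : Fin n) : ‖v i‖ₑ ≤ ‖v‖ₑ := by
  rw [← ofReal_norm, ← ofReal_norm]
  exact ENNReal.ofReal_le_ofReal (PiLp.norm_apply_le v i)

lemma fracSeminorm_apply_le {β p : ℝ} (hp : 0 < p) (u : Euc n → Euc n) (i : Fin n) :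
    fracSeminorm β p (fun x => u x i) ≤ fracSeminorm β p u :=
  fracSeminorm_mono hp (fun x => enorm_euc_apply_le _ i)
    fun x y => by simpa using enorm_euc_apply_le (u x - u y) i

section Approximation

/-- A Lipschitz cutoff function equal to `1` on the ball of radius `k`. -/
noncomputable def cutoff (k : ℕ) (x : Euc n) : ℝ := max 0 (min 1 (k + 1 - ‖x‖))

lemma cutoff_nonneg (k : ℕ) (x : Euc n) : 0 ≤ cutoff k x := le_max_left _ _

lemma cutoff_le_one (k : ℕ) (x : Euc n) : cutoff k x ≤ 1 :=
  max_le zero_le_one (min_le_left _ _)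

lemma continuous_cutoff (k : ℕ) : Continuous (cutoff (n := n) k) := by
  unfold cutoff; fun_prop

lemma hasCompactSupport_cutoff (k : ℕ) : HasCompactSupport (cutoff (n := n) k) := by
  refine HasCompactSupport.intro (isCompact_closedBall 0 ((k : ℝ) + 1)) fun x hx => ?_
  rw [mem_closedBall_zero_iff, not_le] at hx
  exact max_eq_left ((min_le_right _ _).trans (by linarith))

lemma cutoff_eq_one {k : ℕ} {x : Euc n} (h : ‖x‖ ≤ k) : cutoff k x = 1 := by
  unfold cutoff
  rw [min_eq_left (by linarith), max_eq_right zero_le_one]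

lemma abs_cutoff_sub_le (k : ℕ) (x t : Euc n) :
    |cutoff k (x - t) - cutoff k x| ≤ min 1 ‖t‖ := by
  refine le_min ?_ ?_
  · exact abs_sub_le_of_nonneg_of_le (cutoff_nonneg _ _) (cutoff_le_one _ _) (cutoff_nonneg _ _)
      (cutoff_le_one _ _)
  · unfold cutoff
    refine (abs_max_sub_max_le_max _ _ _ _).trans (max_le (by simp) ?_)
    refine (abs_min_sub_min_le_max _ _ _ _).trans (max_le (by simp) ?_)
    rw [sub_sub_sub_cancel_left]
    refine (abs_norm_sub_norm_le _ _).trans ?_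
    simp

/-- In polar coordinates the integrand is `y^(p(1-β)-1)` near zero, integrable because `β < 1`, and
`y^(-1-βp)` at infinity, integrable because `β > 0`. -/
lemma lintegral_weight_lt_top (hn : 1 ≤ n) {β p : ℝ} (hβ : 0 < β) (hβ1 : β < 1) (hp : 0 < p) :
    ∫⁻ t : Euc n, ENNReal.ofReal (min 1 ‖t‖) ^ p / ‖t‖ₑ ^ ((n : ℝ) + β * p) ≠ ⊤ := by
  have : Nontrivial (Euc n) := Module.nontrivial_of_finrank_pos (R := ℝ) (by simp; omega)
  set f : ℝ → ℝ := fun y => min 1 y ^ p * y ^ (-((n : ℝ) + β * p)) with hf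
  have h1 : IntegrableOn (fun y : ℝ => y ^ (Module.finrank ℝ (Euc n) - 1) • f y) (Set.Ioi 0) := by
    rw [← Set.Ioc_union_Ioi_eq_Ioi zero_le_one]
    have hpow : ∀ y : ℝ, 0 < y → y ^ (Module.finrank ℝ (Euc n) - 1) = y ^ ((n : ℝ) - 1) := by
      intro y hy
      rw [finrank_euclideanSpace, Fintype.card_fin, ← Real.rpow_natCast, Nat.cast_sub hn,
        Nat.cast_one]
    refine IntegrableOn.union ?_ ?_
    · have h2 : IntegrableOn (fun y : ℝ => y ^ (p * (1 - β) - 1)) (Set.Ioc 0 1) := by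
        rw [← intervalIntegrable_iff_integrableOn_Ioc_of_le zero_le_one]
        exact intervalIntegral.intervalIntegrable_rpow' (by nlinarith)
      refine h2.congr_fun (fun y hy => ?_) measurableSet_Ioc
      simp only [hf, smul_eq_mul]
      rw [hpow y hy.1, min_eq_right hy.2, ← Real.rpow_add hy.1, ← Real.rpow_add hy.1]
      congr 1; ring
    · have h2 : IntegrableOn (fun y : ℝ => y ^ (-1 - β * p)) (Set.Ioi 1) :=
        integrableOn_Ioi_rpow_of_lt (by nlinarith) zero_lt_one
      refine h2.congr_fun (fun y hy => ?_) measurableSet_Ioi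
      have hy0 : 0 < y := zero_lt_one.trans hy
      simp only [hf, smul_eq_mul]
      rw [hpow y hy0, min_eq_left (le_of_lt hy), Real.one_rpow, one_mul, ← Real.rpow_add hy0]
      congr 1; ring
  have h2 := (integrable_fun_norm_addHaar (volume : Measure (Euc n))).2 h1
  have h3 := h2.lintegral_lt_top.ne
  convert h3 using 1
  have h0 : ∀ᵐ t : Euc n, t ≠ 0 := by
    simp [ae_iff]
  refine lintegral_congr_ae ?_
  filter_upwards [h0] with t ht
  have ht' : 0 < ‖t‖ := norm_pos_iff.2 ht
  rw [ENNReal.ofReal_rpow_of_pos (by positivity), ← ofReal_norm, ENNReal.ofReal_rpow_of_pos ht',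
    div_eq_mul_inv, ← ENNReal.ofReal_inv_of_pos (by positivity), ← ENNReal.ofReal_mul (by positivity),
    ← Real.rpow_neg ht'.le]

lemma memLp_cutoff_smul {F : Type*} [NormedAddCommGroup F] [NormedSpace ℝ F]
    {q : ℝ≥0∞} {u : Euc n → F} (hu : MemLp u q volume) (k : ℕ) :
    MemLp (fun x => cutoff k x • u x) q volume := by
  refine hu.mono ((continuous_cutoff k).aestronglyMeasurable.smul hu.1)
    (Eventually.of_forall fun x => ?_)
  rw [norm_smul, Real.norm_of_nonneg (cutoff_nonneg _ _)]
  exact mul_le_of_le_one_left (norm_nonneg _) (cutoff_le_one _ _)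

lemma eLpNorm_moll_le {F : Type*} [NormedAddCommGroup F] [NormedSpace ℝ F]
    [MeasurableSpace F] [BorelSpace F] (hn : 1 ≤ n) {r : ℝ} (hr : 0 < r) {u : Euc n → F}
    (hu : Measurable u) : eLpNorm (moll r u) n volume ≤ eLpNorm u n volume := by
  rw [eLpNorm_natCast_eq hn, eLpNorm_natCast_eq hn]
  gcongr ?_ ^ _
  exact lintegral_moll_rpow_le (by exact_mod_cast hn) hr hu

lemma IsSmoothApprox.congr_ae {F : Type*} [NormedAddCommGroup F] [NormedSpace ℝ F]
    {β p : ℝ} {u u' : Euc n → F} {w : ℕ → Euc n → F}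
    (h : IsSmoothApprox β p u w) (huu' : u =ᵐ[volume] u') : IsSmoothApprox β p u' w := by
  have e : ∀ k, (w k - u) =ᵐ[volume] (w k - u') := fun k => by
    filter_upwards [huu'] with x hx
    simp [hx]
  refine ⟨h.1, ?_, ?_⟩
  · simpa only [eLpNorm_congr_ae (e _)] using h.2.1
  · simpa only [fracSeminorm_congr_ae (e _)] using h.2.2

variable {F : Type*} [NormedAddCommGroup F] [NormedSpace ℝ F]
  [MeasurableSpace F] [BorelSpace F] [SecondCountableTopology F]

/-- A discrete Leibniz rule; the cutoffs are bounded by 1 and 1-Lipschitz, so the bound is uniform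
in `k`. -/
lemma shiftEnergy_cutoff_le {p : ℝ} (hp : 1 ≤ p) {u : Euc n → F} (hu : Measurable u) (k : ℕ)
    (t : Euc n) : shiftEnergy p (fun x => cutoff k x • u x) t
      ≤ 2 ^ (p - 1) * (shiftEnergy p u t + ENNReal.ofReal (min 1 ‖t‖) ^ p * ∫⁻ x, ‖u x‖ₑ ^ p) := by
  have hp0 : 0 < p := by linarith
  rw [shiftEnergy, shiftEnergy, ← lintegral_const_mul' _ _ (ENNReal.rpow_ne_top_of_nonneg hp0.le
    ENNReal.ofReal_ne_top), ← lintegral_add_left, ← lintegral_const_mul' _ _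
    (ENNReal.rpow_ne_top_of_nonneg (by linarith) (by simp))]
  · refine lintegral_mono fun x => ?_
    refine le_trans (ENNReal.rpow_le_rpow (z := p) ?_ hp0.le)
      (ENNReal.rpow_add_le_mul_rpow_add_rpow ‖u (x - t) - u x‖ₑ
        (ENNReal.ofReal (min 1 ‖t‖) * ‖u x‖ₑ) hp) |>.trans_eq ?_
    · have e : cutoff k (x - t) • u (x - t) - cutoff k x • u x
          = cutoff k (x - t) • (u (x - t) - u x) + (cutoff k (x - t) - cutoff k x) • u x := by
        rw [smul_sub, sub_smul]; abel
      rw [e]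
      refine (enorm_add_le _ _).trans ?_
      rw [enorm_smul, enorm_smul]
      gcongr
      · refine mul_le_of_le_one_left zero_le ?_
        rw [Real.enorm_of_nonneg (cutoff_nonneg _ _)]
        exact ENNReal.ofReal_le_one.2 (cutoff_le_one _ _)
      · rw [Real.enorm_eq_ofReal_abs]
        exact ENNReal.ofReal_le_ofReal (abs_cutoff_sub_le k x t)
    · rw [ENNReal.mul_rpow_of_nonneg _ _ hp0.le]
  · exact ((measurable_shift_sub hu).comp measurable_prodMk_right).pow_const p

/-- Mollification commutes with translations, so Young's inequality applies to the difference of `u`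
and its translate. -/
lemma shiftEnergy_moll_le [CompleteSpace F] {p r : ℝ} (hp : 1 ≤ p) (hr : 0 < r) {u : Euc n → F}
    (hu : Measurable u) (hul : MemLp u (ENNReal.ofReal p) volume) (t : Euc n) :
    shiftEnergy p (moll r u) t ≤ shiftEnergy p u t := by
  have hp1 : 1 ≤ ENNReal.ofReal p := by simpa using hp
  have hul' : LocallyIntegrable (fun x => u (x - t)) := by
    exact (hul.comp_measurePreserving (measurePreserving_sub_right volume t)).locallyIntegrable hp1
  have h : ∀ x, moll r u (x - t) - moll r u x = moll r (fun y => u (y - t) - u y) x := by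
    intro x
    rw [moll_sub hr hul' (hul.locallyIntegrable hp1)]
    congr 1
    simp only [moll_apply, sub_right_comm]
  unfold shiftEnergy
  simp_rw [h]
  exact lintegral_moll_rpow_le hp hr ((hu.comp (measurable_id.sub_const t)).sub hu)

lemma tendsto_lintegral_cutoff {p : ℝ} (hp : 0 < p) {u : Euc n → F} (hu : Measurable u)
    (hup : ∫⁻ x, ‖u x‖ₑ ^ p ≠ ⊤) :
    Tendsto (fun k => ∫⁻ x, ‖cutoff k x • u x - u x‖ₑ ^ p) atTop (𝓝 0) := by
  rw [← lintegral_zero (μ := (volume : Measure (Euc n)))]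
  refine tendsto_lintegral_of_dominated_convergence (fun x => ‖u x‖ₑ ^ p)
    (fun k => ((((continuous_cutoff k).measurable.smul hu).sub hu).enorm.pow_const p))
    (fun k => Eventually.of_forall fun x => ?_) hup (Eventually.of_forall fun x => ?_)
  · have e : cutoff k x • u x - u x = -((1 - cutoff k x) • u x) := by
      rw [sub_smul, one_smul]; abel
    simp only
    rw [e, enorm_neg, enorm_smul]
    gcongr
    refine mul_le_of_le_one_left zero_le ?_
    rw [Real.enorm_of_nonneg (sub_nonneg.2 (cutoff_le_one _ _))]
    exact ENNReal.ofReal_le_one.2 (by linarith [cutoff_nonneg k x])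
  · refine tendsto_const_nhds.congr' ?_
    filter_upwards [eventually_ge_atTop ⌈‖x‖⌉₊] with k hk
    rw [cutoff_eq_one (Nat.ceil_le.1 hk)]
    simp [hp]

/-- The finite Gagliardo seminorm gives the explicit rate `r^β`. -/
lemma tendsto_eLpNorm_moll_sub [CompleteSpace F] (hn : 1 ≤ n) {β : ℝ} (hβ : 0 < β) {u : Euc n → F}
    (hu : Measurable u) (hul : LocallyIntegrable u) (hug : gagliardoSeminorm β n u ≠ ⊤) {r : ℕ → ℝ}
    (hr : ∀ k, 0 < r k) (hr0 : Tendsto r atTop (𝓝 0)) :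
    Tendsto (fun k => eLpNorm (fun x => moll (r k) u x - u x) n volume) atTop (𝓝 0) := by
  have hn0 : (0 : ℝ) < n := by positivity
  obtain ⟨M, hM⟩ := exists_eLpNorm_moll_bound n hn F
  have hb : ∀ k, eLpNorm (fun x => moll (r k) u x - u x) n volume
      ≤ M * gagliardoSeminorm β n u * ENNReal.ofReal (r k) ^ β := by
    intro k
    refine (hM _ (hr k) u hul hu).1.trans ?_
    have hR : ENNReal.ofReal (r k) ≠ 0 := by simpa using hr k
    have hR' : ENNReal.ofReal (r k) ≠ ⊤ := by simp
    have h1 : osc n (r k) u ^ (1 / (n : ℝ))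
        ≤ ENNReal.ofReal (r k) * ENNReal.ofReal (r k) ^ β * gagliardoSeminorm β n u := by
      refine (ENNReal.rpow_le_rpow (osc_le_gagliardo hn0 (s := (n : ℝ) + β * n) (r := r k)
        (by positivity) u) (by positivity)).trans_eq ?_
      rw [gagliardoSeminorm_eq_shiftEnergy β n hu, ENNReal.mul_rpow_of_nonneg _ _ (by positivity),
        ← ENNReal.rpow_mul]
      congr 1
      conv_rhs => rw [← ENNReal.rpow_one (ENNReal.ofReal (r k)), ← ENNReal.rpow_mul, one_mul,
        ← ENNReal.rpow_add _ _ hR hR']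
      congr 1
      field_simp
    calc _ ≤ (M : ℝ≥0∞) * ((ENNReal.ofReal (r k))⁻¹ * (ENNReal.ofReal (r k) *
          ENNReal.ofReal (r k) ^ β * gagliardoSeminorm β n u)) := by gcongr
      _ = ((ENNReal.ofReal (r k))⁻¹ * ENNReal.ofReal (r k)) *
          (M * gagliardoSeminorm β n u * ENNReal.ofReal (r k) ^ β) := by ring
      _ = _ := by rw [ENNReal.inv_mul_cancel hR hR', one_mul]
  refine tendsto_of_tendsto_of_tendsto_of_le_of_le tendsto_const_nhds ?_ (fun _ => zero_le) hb
  have h2 : Tendsto (fun k => ENNReal.ofReal (r k) ^ β) atTop (𝓝 0) := by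
    have h3 : Continuous fun r : ℝ => ENNReal.ofReal r ^ β :=
      ENNReal.continuous_rpow_const.comp ENNReal.continuous_ofReal
    have := (h3.tendsto 0).comp hr0
    simpa [Function.comp_def, hβ] using this
  simpa using ENNReal.Tendsto.const_mul h2 (Or.inr (ENNReal.mul_ne_top ENNReal.coe_ne_top hug))

/-- Density of smooth compactly supported functions in `W^{β,n}` for `0 < β < 1`. -/
lemma exists_isSmoothApprox_of_measurable [CompleteSpace F] (hn : 1 ≤ n) {β : ℝ} (hβ : 0 < β)
    (hβ1 : β < 1) {u : Euc n → F} (hum : Measurable u) (hu : MemFracSobolev β n u) :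
    ∃ w, IsSmoothApprox β n u w := by
  have hn0 : (0 : ℝ) < n := by positivity
  have hn1 : (1 : ℝ) ≤ n := by exact_mod_cast hn
  have hn1' : (1 : ℝ≥0∞) ≤ n := by exact_mod_cast hn
  obtain ⟨huL, hug⟩ := hu
  rw [fracSeminorm, if_neg hβ.ne'] at hug
  set s : ℝ := (n : ℝ) + β * n with hs
  have huL' : MemLp u n volume := by simpa using huL
  have hul : LocallyIntegrable u := huL'.locallyIntegrable hn1'
  have hU : ∫⁻ x, ‖u x‖ₑ ^ (n : ℝ) ≠ ⊤ := by
    have h := huL'.eLpNorm_ne_top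
    rw [eLpNorm_natCast_eq hn] at h
    intro h'
    exact h (by rw [h']; exact ENNReal.top_rpow_of_pos (by positivity))
  have hE : ∫⁻ t, shiftEnergy n u t / ‖t‖ₑ ^ s ≠ ⊤ := by
    have h := hug.ne
    rw [gagliardoSeminorm_eq_shiftEnergy β n hum] at h
    intro h'
    exact h (by rw [h']; exact ENNReal.top_rpow_of_pos (by positivity))
  set r : ℕ → ℝ := fun k => 1 / ((k : ℝ) + 1) with hr_def
  have hr : ∀ k, 0 < r k := fun k => by positivity
  have hr0 : Tendsto r atTop (𝓝 0) := tendsto_one_div_add_atTop_nhds_zero_nat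
  set v : ℕ → Euc n → F := fun k x => cutoff k x • u x with hv
  have hvm : ∀ k, Measurable (v k) := fun k => (continuous_cutoff k).measurable.smul hum
  have hvL : ∀ k, MemLp (v k) n volume := fun k => memLp_cutoff_smul huL' k
  have hvl : ∀ k, LocallyIntegrable (v k) := fun k => (hvL k).locallyIntegrable hn1'
  have hvc : ∀ k, HasCompactSupport (v k) := fun k => (hasCompactSupport_cutoff k).smul_right
  set w : ℕ → Euc n → F := fun k => moll (r k) (v k) with hw
  have hwm : ∀ k, Measurable (w k) := fun k => (contDiff_moll (hr k) (hvl k)).continuous.measurable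
  have hL : Tendsto (fun k => eLpNorm (fun x => w k x - u x) n volume) atTop (𝓝 0) := by
    have hb : ∀ k, eLpNorm (fun x => w k x - u x) n volume
        ≤ eLpNorm (fun x => v k x - u x) n volume
          + eLpNorm (fun x => moll (r k) u x - u x) n volume := by
      intro k
      -- Mollifying the cutoff error does not increase its `Lⁿ` norm, so cutoff and mollification
      -- can be removed separately.
      have e : (fun x => w k x - u x)
          = (moll (r k) fun x => v k x - u x) + fun x => moll (r k) u x - u x := by
        ext x
        rw [Pi.add_apply, moll_sub (hr k) (hvl k) hul]
        simp [hw]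
      rw [e]
      have m1 : AEStronglyMeasurable (moll (r k) fun x => v k x - u x) volume :=
        (contDiff_moll (hr k) ((hvl k).sub hul)).continuous.aestronglyMeasurable
      have m2 : AEStronglyMeasurable (fun x => moll (r k) u x - u x) volume :=
        (contDiff_moll (hr k) hul).continuous.aestronglyMeasurable.sub huL'.1
      refine (eLpNorm_add_le m1 m2 hn1').trans ?_
      gcongr
      exact eLpNorm_moll_le hn (hr k) ((hvm k).sub hum)
    have t1 : Tendsto (fun k => eLpNorm (fun x => v k x - u x) n volume) atTop (𝓝 0) := by
      simp_rw [eLpNorm_natCast_eq hn]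
      have h5 := (ENNReal.continuous_rpow_const (y := 1 / (n : ℝ))).tendsto 0
      rw [ENNReal.zero_rpow_of_pos (by positivity)] at h5
      exact h5.comp (tendsto_lintegral_cutoff hn0 hum hU)
    have t2 := tendsto_eLpNorm_moll_sub hn hβ hum hul hug.ne hr hr0
    have t3 := t1.add t2
    rw [add_zero] at t3
    exact tendsto_of_tendsto_of_tendsto_of_le_of_le tendsto_const_nhds t3 (fun _ => zero_le) hb
  refine ⟨w, fun k => ⟨contDiff_moll (hr k) (hvl k), hasCompactSupport_moll (hr k) (hvc k)⟩, ?_, ?_⟩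
  · simpa using! hL
  · simp only [fracSeminorm, if_neg hβ.ne']
    set c : ℝ≥0∞ := 2 ^ ((n : ℝ) - 1) with hc
    have hctop : c ≠ ⊤ := ENNReal.rpow_ne_top_of_nonneg (by linarith) (by simp)
    -- A majorant independent of `k`: one factor `c` comes from splitting `w k - u`, the inner one
    -- from the Leibniz rule for the cutoff.
    set G : Euc n → ℝ≥0∞ := fun t => c * (c * (shiftEnergy n u t +
      ENNReal.ofReal (min 1 ‖t‖) ^ (n : ℝ) * ∫⁻ x, ‖u x‖ₑ ^ (n : ℝ)) + shiftEnergy n u t) with hG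
    refine tendsto_gagliardoSeminorm_zero (w := fun k => w k - u) hn1
      (fun k => (hwm k).sub hum) ?_ (G := G) (fun k t => ?_) ?_
    · have h5 := (ENNReal.continuous_rpow_const (y := (n : ℝ))).tendsto 0
      rw [ENNReal.zero_rpow_of_pos hn0] at h5
      refine (h5.comp hL).congr fun k => ?_
      simp only [Function.comp_def]
      rw [eLpNorm_natCast_eq hn, ← ENNReal.rpow_mul, one_div_mul_cancel hn0.ne', ENNReal.rpow_one]
      rfl
    · have h1 : shiftEnergy n (w k - u) t ≤ c * (shiftEnergy n (w k) t + shiftEnergy n u t) := by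
        refine le_trans (le_of_eq ?_) (lintegral_enorm_sub_rpow_le (p := (n : ℝ)) hn1
          (f := fun x => w k (x - t) - w k x) (g := fun x => u (x - t) - u x) ?_)
        · unfold shiftEnergy
          refine lintegral_congr fun x => ?_
          rw [Pi.sub_apply, Pi.sub_apply, sub_sub_sub_comm]
        · exact (((measurable_shift_sub (hwm k)).comp
            measurable_prodMk_right).pow_const _).aemeasurable
      refine h1.trans ?_
      simp only [hG]
      gcongr
      refine (shiftEnergy_moll_le hn1 (hr k) (hvm k) (by simpa using hvL k) t).trans ?_
      exact shiftEnergy_cutoff_le hn1 hum k t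
    · have e : ∀ t, G t / ‖t‖ₑ ^ s = (c * c + c) * (shiftEnergy n u t / ‖t‖ₑ ^ s)
          + c * c * (∫⁻ x, ‖u x‖ₑ ^ (n : ℝ)) *
            (ENNReal.ofReal (min 1 ‖t‖) ^ (n : ℝ) / ‖t‖ₑ ^ s) := by
        intro t
        simp only [hG, div_eq_mul_inv]
        ring
      rw [← hs]
      simp_rw [e]
      have hcc : c * c + c ≠ ⊤ := ENNReal.add_ne_top.2 ⟨ENNReal.mul_ne_top hctop hctop, hctop⟩
      have hcU : c * c * (∫⁻ x, ‖u x‖ₑ ^ (n : ℝ)) ≠ ⊤ :=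
        ENNReal.mul_ne_top (ENNReal.mul_ne_top hctop hctop) hU
      rw [lintegral_add_left, lintegral_const_mul' _ _ hcc, lintegral_const_mul' _ _ hcU]
      · exact ENNReal.add_ne_top.2 ⟨ENNReal.mul_ne_top hcc hE, ENNReal.mul_ne_top hcU
          (lintegral_weight_lt_top hn hβ hβ1 hn0)⟩
      · exact ((measurable_shiftEnergy _ hum).div (measurable_enorm.pow_const _)).const_mul _

/-- Density of smooth compactly supported functions in `W^{β,n}` for `0 ≤ β < 1`. -/
lemma exists_isSmoothApprox [CompleteSpace F] (hn : 1 ≤ n) {β : ℝ} (hβ : 0 ≤ β)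
    (hβ1 : β < 1) {u : Euc n → F} (hu : MemFracSobolev β n u) :
    ∃ w, IsSmoothApprox β n u w := by
  rcases hβ.eq_or_lt with h0 | h0
  · subst h0
    have h : ∀ k : ℕ, ∃ g : Euc n → F, HasCompactSupport g ∧ ContDiff ℝ ∞ g ∧
        eLpNorm (u - g) (ENNReal.ofReal (n : ℝ)) volume ≤ ENNReal.ofReal (1 / ((k : ℝ) + 1)) :=
      fun k => hu.1.exist_eLpNorm_sub_le ENNReal.ofReal_ne_top (by simpa using hn) (by positivity)
    choose w hwc hws hwl using h
    have t : Tendsto (fun k => eLpNorm (w k - u) (ENNReal.ofReal (n : ℝ)) volume) atTop (𝓝 0) := by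
      have t1 := ENNReal.tendsto_ofReal (tendsto_one_div_add_atTop_nhds_zero_nat (𝕜 := ℝ))
      rw [ENNReal.ofReal_zero] at t1
      refine tendsto_of_tendsto_of_tendsto_of_le_of_le tendsto_const_nhds t1 (fun _ => zero_le)
        fun k => ?_
      rw [eLpNorm_sub_comm]
      exact hwl k
    exact ⟨w, fun k => ⟨hws k, hwc k⟩, t, by simpa only [fracSeminorm, if_true] using t⟩
  · obtain ⟨hu1, hu2⟩ := hu
    -- The translation arguments use a measurable function; the norm and the seminorm only see the
    -- almost everywhere class.
    set u' := hu1.1.mk u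
    have e : u =ᵐ[volume] u' := hu1.1.ae_eq_mk
    obtain ⟨w, hw⟩ := exists_isSmoothApprox_of_measurable hn h0 hβ1
      (hu1.1.stronglyMeasurable_mk.measurable)
      (show MemFracSobolev β n u' from ⟨hu1.ae_eq e, by rwa [← fracSeminorm_congr_ae e]⟩)
    exact ⟨w, hw.congr_ae e.symm⟩

end Approximation

end Density

/-! ### Stability of the pairing and passage to the limit. -/

section Pairing

variable {n : ℕ}

lemma det_fderiv_eq_jac {w : Euc n → Euc n} (hw : ContDiff ℝ ∞ w) (x : Euc n) :
    (fderiv ℝ w x).det = jac (fun i y => w y i) x := by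
  have hd : DifferentiableAt ℝ w x := hw.differentiable (by simp) x
  have e : ∀ i k, gradRow (fun y => w y i) x k = fderiv ℝ w x (EuclideanSpace.single k 1) i := by
    intro i k
    have h : HasFDerivAt (fun y => w y i) ((EuclideanSpace.proj i).comp (fderiv ℝ w x)) x :=
      (EuclideanSpace.proj i : Euc n →L[ℝ] ℝ).hasFDerivAt.comp x hd.hasFDerivAt
    rw [gradRow, h.fderiv]
    rfl
  rw [ContinuousLinearMap.det, ← LinearMap.det_toMatrix (EuclideanSpace.basisFun (Fin n) ℝ).toBasis,
    jac]
  congr 1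
  ext i k
  rw [LinearMap.toMatrix_apply, Matrix.of_apply, e]
  simp

lemma smoothJacobianIntegral_eq {w : Euc n → Euc n} (hw : ContDiff ℝ ∞ w) (φ : Euc n → ℝ) :
    smoothJacobianIntegral w φ = ∫ x, jac (fun i y => w y i) x * φ x := by
  unfold smoothJacobianIntegral
  simp_rw [det_fderiv_eq_jac hw]

lemma contDiff_euc_apply {w : Euc n → Euc n} (hw : ContDiff ℝ ∞ w) (i : Fin n) :
    ContDiff ℝ ∞ fun x => w x i := (contDiff_piLp 2).1 hw i

lemma hasCompactSupport_euc_apply {w : Euc n → Euc n} (hw : HasCompactSupport w) (i : Fin n) :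
    HasCompactSupport fun x => w x i :=
  hw.comp_left (g := fun v : Euc n => v i) rfl

/-- The right-hand side of the stability estimate. -/
noncomputable def jacobianDist (β : ℝ) (u v : Euc n → Euc n) : ℝ :=
  ∑ j : Fin n, (fracSeminorm β n (fun x => u x j - v x j)).toReal *
    (∏ i ∈ Finset.Iio j, (fracSeminorm β n (fun x => v x i)).toReal) *
    ∏ i ∈ Finset.Ioi j, (fracSeminorm β n (fun x => u x i)).toReal

lemma prod_hybrid_eq (N : (Euc n → ℝ) → ℝ≥0∞) (f g : Fin n → Euc n → ℝ) (j : Fin n) :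
    ∏ i, N (hybrid f g j i)
      = N (fun x => f j x - g j x) * (∏ i ∈ Finset.Iio j, N (g i)) * ∏ i ∈ Finset.Ioi j, N (f i) := by
  have h : (Finset.univ : Finset (Fin n)).erase j = Finset.Iio j ∪ Finset.Ioi j := by
    ext i
    simp [lt_or_lt_iff_ne]
  have hd : Disjoint (Finset.Iio j) (Finset.Ioi j) := by
    rw [Finset.disjoint_left]
    intro i hi hi'
    exact absurd (Finset.mem_Iio.1 hi) (Finset.mem_Ioi.1 hi').not_gt
  rw [← Finset.mul_prod_erase _ _ (Finset.mem_univ j), h, Finset.prod_union hd, hybrid_self,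
    mul_assoc]
  congr 2
  · exact Finset.prod_congr rfl fun i hi => by rw [hybrid_of_lt f g (Finset.mem_Iio.1 hi)]
  · exact Finset.prod_congr rfl fun i hi => by rw [hybrid_of_gt f g (Finset.mem_Ioi.1 hi)]

lemma abs_le_of_enorm_le {a : ℝ} {b : ℝ≥0∞} (hb : b ≠ ⊤) (h : ‖a‖ₑ ≤ b) : |a| ≤ b.toReal := by
  rw [Real.enorm_eq_ofReal_abs] at h
  exact (ENNReal.ofReal_le_iff_le_toReal hb).1 h

/-- Real-valued form of the smooth estimates, for maps with finite seminorms. -/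
lemma exists_smoothJacobianIntegral_bound (hn : 1 ≤ n) {α : ℝ≥0} {β : ℝ}
    (hβ : β ∈ Set.Ico (((n : ℝ) - 1) / n) 1) (hα : α ∈ Set.Ioc (0 : ℝ≥0) 1)
    (hαβ : (α : ℝ) / n = 1 - β) :
    ∃ C : ℝ, 0 < C ∧ ∀ (φ : Euc n → ℝ) (H : ℝ≥0), HolderWith H α φ → ∀ u : Euc n → Euc n,
      ContDiff ℝ ∞ u → HasCompactSupport u → (∀ i, fracSeminorm β n (fun x => u x i) < ⊤) →
      |smoothJacobianIntegral u φ| ≤ C * H * ∏ i, (fracSeminorm β n (fun x => u x i)).toReal ∧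
      ∀ v : Euc n → Euc n, ContDiff ℝ ∞ v → HasCompactSupport v →
        (∀ i, fracSeminorm β n (fun x => v x i) < ⊤) →
        |smoothJacobianIntegral u φ - smoothJacobianIntegral v φ| ≤ C * H * jacobianDist β u v := by
  obtain ⟨C, hC⟩ := exists_jac_bound hn hβ hα hαβ
  have hn1 : (1 : ℝ) ≤ n := by exact_mod_cast hn
  have hbound : ∀ (φ : Euc n → ℝ) (H : ℝ≥0), HolderWith H α φ → ∀ f : Fin n → Euc n → ℝ,
      (∀ i, ContDiff ℝ ∞ (f i)) → (∀ i, HasCompactSupport (f i)) →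
      (∀ i, fracSeminorm β n (f i) ≠ ⊤) →
      |∫ x, jac f x * φ x| ≤ (C + 1) * H * ∏ i, (fracSeminorm β n (f i)).toReal := by
    intro φ H hφ f hf hfc hfin
    have h := abs_le_of_enorm_le ?_ (hC f hf hfc φ H (hφ.continuous hα.1) hφ)
    · rw [ENNReal.toReal_mul, ENNReal.toReal_mul, ENNReal.toReal_prod] at h
      refine h.trans ?_
      simp only [ENNReal.coe_toReal]
      gcongr
      linarith
    · exact ENNReal.mul_ne_top (ENNReal.mul_ne_top ENNReal.coe_ne_top ENNReal.coe_ne_top)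
        (ENNReal.prod_ne_top fun i _ => hfin i)
  -- The constant is enlarged by 1 because `C` may vanish.
  refine ⟨C + 1, by positivity, fun φ H hφ u hu huc hufin => ⟨?_, fun v hv hvc hvfin => ?_⟩⟩
  · rw [smoothJacobianIntegral_eq hu]
    exact hbound φ H hφ _ (contDiff_euc_apply hu) (hasCompactSupport_euc_apply huc)
      fun i => (hufin i).ne
  · set f : Fin n → Euc n → ℝ := fun i x => u x i with hf
    set g : Fin n → Euc n → ℝ := fun i x => v x i with hg
    have hfs : ∀ i, ContDiff ℝ ∞ (f i) := contDiff_euc_apply hu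
    have hgs : ∀ i, ContDiff ℝ ∞ (g i) := contDiff_euc_apply hv
    have hfc : ∀ i, HasCompactSupport (f i) := hasCompactSupport_euc_apply huc
    have hgc : ∀ i, HasCompactSupport (g i) := hasCompactSupport_euc_apply hvc
    have hφc : Continuous φ := hφ.continuous hα.1
    have e : smoothJacobianIntegral u φ - smoothJacobianIntegral v φ
        = ∑ j, ∫ x, jac (hybrid f g j) x * φ x := by
      rw [smoothJacobianIntegral_eq hu, smoothJacobianIntegral_eq hv,
        ← integral_sub (integrable_jac_mul hn hfs hfc hφc) (integrable_jac_mul hn hgs hgc hφc),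
        ← integral_finsetSum _ fun j _ => integrable_jac_mul hn (contDiff_hybrid hfs hgs j)
          (hasCompactSupport_hybrid hfc hgc j) hφc]
      refine integral_congr_ae (Eventually.of_forall fun x => ?_)
      simp only
      rw [← sub_mul, jac_sub_jac hfs hgs, Finset.sum_mul]
    have hfin : ∀ j i, fracSeminorm β n (hybrid f g j i) ≠ ⊤ := by
      intro j i
      rcases lt_trichotomy i j with h | h | h
      · rw [hybrid_of_lt f g h]; exact (hvfin i).ne
      · subst h
        rw [hybrid_self]
        have h1 := fracSeminorm_add_le (β := β) hn1
          (hfs i).continuous.aestronglyMeasurable (hgs i).neg.continuous.aestronglyMeasurable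
        have h2 : fracSeminorm β n (fun x => - g i x) ≤ fracSeminorm β n (g i) :=
          fracSeminorm_mono (by linarith) (fun x => by simp) fun x y => by
            rw [← enorm_neg]; simp [sub_eq_add_neg, add_comm]
        simp only [← sub_eq_add_neg] at h1
        exact (h1.trans_lt (ENNReal.add_lt_top.2 ⟨hufin i, h2.trans_lt (hvfin i)⟩)).ne
      · rw [hybrid_of_gt f g h]; exact (hufin i).ne
    rw [e, jacobianDist, Finset.mul_sum]
    refine (Finset.abs_sum_le_sum_abs _ _).trans (Finset.sum_le_sum fun j _ => ?_)
    refine (hbound φ H hφ _ (contDiff_hybrid hfs hgs j) (hasCompactSupport_hybrid hfc hgc j)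
      (hfin j)).trans_eq ?_
    rw [← ENNReal.toReal_prod, prod_hybrid_eq, ENNReal.toReal_mul, ENNReal.toReal_mul,
      ENNReal.toReal_prod, ENNReal.toReal_prod]

section Limits

variable {ι : Type*} {l : Filter ι} {β : ℝ}

/-- The triangle inequality in both directions. Subtraction in `ℝ≥0∞` is truncated, so no finiteness
of the seminorms of `f k` is required. -/
lemma tendsto_fracSeminorm {F : Type*} [NormedAddCommGroup F] {p : ℝ} (hp : 1 ≤ p)
    {f : ι → Euc n → F} {g : Euc n → F} (hf : ∀ k, AEStronglyMeasurable (f k))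
    (hg : AEStronglyMeasurable g) (hgf : fracSeminorm β p g < ⊤)
    (h : Tendsto (fun k => fracSeminorm β p (fun x => f k x - g x)) l (𝓝 0)) :
    Tendsto (fun k => fracSeminorm β p (f k)) l (𝓝 (fracSeminorm β p g)) := by
  have h1 : ∀ k, fracSeminorm β p (f k)
      ≤ fracSeminorm β p g + fracSeminorm β p (fun x => f k x - g x) := fun k => by
    simpa using! fracSeminorm_add_le (β := β) hp hg ((hf k).sub hg)
  have h2 : ∀ k, fracSeminorm β p g - fracSeminorm β p (fun x => f k x - g x)
      ≤ fracSeminorm β p (f k) := fun k => by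
    rw [tsub_le_iff_right, fracSeminorm_sub_comm (by linarith)]
    simpa using! fracSeminorm_add_le (β := β) hp (hf k) (hg.sub (hf k))
  refine tendsto_of_tendsto_of_tendsto_of_le_of_le ?_ ?_ h2 h1
  · simpa using ENNReal.Tendsto.sub tendsto_const_nhds h (Or.inl hgf.ne)
  · simpa using tendsto_const_nhds.add h

/-- Convergence of a family of smooth compactly supported maps in the fractional seminorm. -/
structure SmoothTendsto (β : ℝ) (l : Filter ι) (w : ι → Euc n → Euc n) (u : Euc n → Euc n) :
    Prop where
  contDiff : ∀ k, ContDiff ℝ ∞ (w k)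
  compact : ∀ k, HasCompactSupport (w k)
  meas : AEStronglyMeasurable u
  finite : fracSeminorm β n u < ⊤
  tendsto : Tendsto (fun k => fracSeminorm β n (fun x => w k x - u x)) l (𝓝 0)

lemma IsSmoothApprox.smoothTendsto {u : Euc n → Euc n} {w : ℕ → Euc n → Euc n}
    (h : IsSmoothApprox β n u w) (hu : MemFracSobolev β n u) : SmoothTendsto β atTop w u :=
  ⟨fun k => (h.1 k).1, fun k => (h.1 k).2, hu.1.1, hu.2, h.2.2⟩

/-- General filters serve the Cauchy property: a sequence is compared with itself along the two
projections of `ℕ × ℕ`. -/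
lemma SmoothTendsto.comp {κ : Type*} {l' : Filter κ} {w : ι → Euc n → Euc n} {u : Euc n → Euc n}
    (h : SmoothTendsto β l w u) {e : κ → ι} (he : Tendsto e l' l) :
    SmoothTendsto β l' (fun k => w (e k)) u :=
  ⟨fun _ => h.contDiff _, fun _ => h.compact _, h.meas, h.finite, h.tendsto.comp he⟩

lemma aestronglyMeasurable_euc_apply {u : Euc n → Euc n} (hu : AEStronglyMeasurable u) (i : Fin n) :
    AEStronglyMeasurable fun x => u x i :=
  (EuclideanSpace.proj i : Euc n →L[ℝ] ℝ).continuous.comp_aestronglyMeasurable hu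

lemma SmoothTendsto.tendsto_apply (hn : 1 ≤ n) {w : ι → Euc n → Euc n} {u : Euc n → Euc n}
    (h : SmoothTendsto β l w u) (i : Fin n) :
    Tendsto (fun k => fracSeminorm β n (fun x => w k x i)) l
      (𝓝 (fracSeminorm β n (fun x => u x i))) := by
  have hn1 : (1 : ℝ) ≤ n := by exact_mod_cast hn
  refine tendsto_fracSeminorm hn1
    (fun k => aestronglyMeasurable_euc_apply (h.contDiff k).continuous.aestronglyMeasurable i)
    (aestronglyMeasurable_euc_apply h.meas i)
    ((fracSeminorm_apply_le (by linarith) u i).trans_lt h.finite) ?_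
  exact tendsto_of_tendsto_of_tendsto_of_le_of_le tendsto_const_nhds h.tendsto (fun _ => zero_le)
    fun k => fracSeminorm_apply_le (by linarith) (fun x => w k x - u x) i

lemma SmoothTendsto.apply_lt_top (hn : 1 ≤ n) {w : ι → Euc n → Euc n} {u : Euc n → Euc n}
    (h : SmoothTendsto β l w u) (i : Fin n) : fracSeminorm β n (fun x => u x i) < ⊤ :=
  (fracSeminorm_apply_le (by positivity) u i).trans_lt h.finite

/-- Finiteness for the smooth approximants is read off from convergence to a finite limit; this
makes the real-valued estimates available eventually. -/
lemma SmoothTendsto.eventually_lt_top (hn : 1 ≤ n) {w : ι → Euc n → Euc n} {u : Euc n → Euc n}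
    (h : SmoothTendsto β l w u) : ∀ᶠ k in l, ∀ i, fracSeminorm β n (fun x => w k x i) < ⊤ :=
  eventually_all.2 fun i => (h.tendsto_apply hn i).eventually_lt_const (h.apply_lt_top hn i)

lemma SmoothTendsto.tendsto_toReal (hn : 1 ≤ n) {w : ι → Euc n → Euc n} {u : Euc n → Euc n}
    (h : SmoothTendsto β l w u) (i : Fin n) :
    Tendsto (fun k => (fracSeminorm β n (fun x => w k x i)).toReal) l
      (𝓝 (fracSeminorm β n (fun x => u x i)).toReal) :=
  (ENNReal.tendsto_toReal (h.apply_lt_top hn i).ne).comp (h.tendsto_apply hn i)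

lemma SmoothTendsto.sub (hn : 1 ≤ n) {w w' : ι → Euc n → Euc n} {u u' : Euc n → Euc n}
    (h : SmoothTendsto β l w u) (h' : SmoothTendsto β l w' u') :
    SmoothTendsto β l (fun k x => w k x - w' k x) (fun x => u x - u' x) := by
  have hn1 : (1 : ℝ) ≤ n := by exact_mod_cast hn
  have key : ∀ f g : Euc n → Euc n, AEStronglyMeasurable f → AEStronglyMeasurable g →
      fracSeminorm β n (fun x => f x - g x) ≤ fracSeminorm β n f + fracSeminorm β n g := by
    intro f g hf hg
    have h1 := fracSeminorm_add_le (β := β) hn1 hf hg.neg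
    have h2 : fracSeminorm β n (-g) ≤ fracSeminorm β n g :=
      fracSeminorm_mono (by linarith) (fun x => by simp) fun x y => by
        rw [← enorm_neg]; simp [sub_eq_add_neg, add_comm]
    simp only [Pi.neg_apply, ← sub_eq_add_neg] at h1
    exact h1.trans (by gcongr)
  refine ⟨fun k => (h.contDiff k).sub (h'.contDiff k), fun k => (h.compact k).sub (h'.compact k),
    h.meas.sub h'.meas, (key u u' h.meas h'.meas).trans_lt
      (ENNReal.add_lt_top.2 ⟨h.finite, h'.finite⟩), ?_⟩
  have t := h.tendsto.add h'.tendsto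
  rw [add_zero] at t
  refine tendsto_of_tendsto_of_tendsto_of_le_of_le tendsto_const_nhds t (fun _ => zero_le)
    fun k => ?_
  have e : (fun x => w k x - w' k x - (u x - u' x))
      = fun x => (w k x - u x) - (w' k x - u' x) := by
    ext1 x; abel
  rw [e]
  exact key _ _ ((h.contDiff k).continuous.aestronglyMeasurable.sub h.meas)
    ((h'.contDiff k).continuous.aestronglyMeasurable.sub h'.meas)

lemma SmoothTendsto.tendsto_jacobianDist (hn : 1 ≤ n) {w w' : ι → Euc n → Euc n}
    {u u' : Euc n → Euc n} (h : SmoothTendsto β l w u) (h' : SmoothTendsto β l w' u') :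
    Tendsto (fun k => jacobianDist β (w k) (w' k)) l (𝓝 (jacobianDist β u u')) := by
  unfold jacobianDist
  refine tendsto_finsetSum _ fun j _ => Tendsto.mul (Tendsto.mul ?_ ?_) ?_
  · simpa using (h.sub hn h').tendsto_toReal hn j
  · exact tendsto_finsetProd _ fun i _ => h'.tendsto_toReal hn i
  · exact tendsto_finsetProd _ fun i _ => h.tendsto_toReal hn i

end Limits

lemma jacobianDist_self (hn : 1 ≤ n) (β : ℝ) (u : Euc n → Euc n) : jacobianDist β u u = 0 := by
  have hn0 : (0 : ℝ) < n := by positivity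
  have h : fracSeminorm (n := n) β n (fun _ => (0 : ℝ)) = 0 := by
    unfold fracSeminorm gagliardoSeminorm
    split_ifs
    · exact eLpNorm_zero
    · simp [ENNReal.zero_rpow_of_pos hn0, hn0]
  simp [jacobianDist, h]

end Pairing

end FracJacobian

/-! ### The distributional Jacobian pairing and its estimates. -/

theorem mainTheorem5 (n : ℕ) (hn : 1 ≤ n) (β : ℝ) (α : ℝ≥0)
    (hβ : β ∈ Set.Ico (((n : ℝ) - 1) / n) 1) (hα : α ∈ Set.Ioc (0 : ℝ≥0) 1)
    (hαβ : (α : ℝ) / n = 1 - β) :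
    ∃ C : ℝ, 0 < C ∧
      ∀ φ : EuclideanSpace ℝ (Fin n) → ℝ, MemHolder α φ →
        ∃ J : (EuclideanSpace ℝ (Fin n) → EuclideanSpace ℝ (Fin n)) → ℝ,
          (∀ u, FracJacobian.MemFracSobolev β n u →
            FracJacobian.HasJacobianIntegral β u φ (J u)) ∧
          (∀ u, FracJacobian.MemFracSobolev β n u →
            |J u| ≤ C * (nnHolderNorm α φ : ℝ) *
              ∏ i : Fin n, (FracJacobian.fracSeminorm β n (fun x => u x i)).toReal) ∧
          (∀ u v, FracJacobian.MemFracSobolev β n u → FracJacobian.MemFracSobolev β n v →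
            |J u - J v| ≤ C * (nnHolderNorm α φ : ℝ) *
              ∑ j : Fin n,
                (FracJacobian.fracSeminorm β n (fun x => u x j - v x j)).toReal *
                  (∏ i ∈ Finset.Iio j,
                    (FracJacobian.fracSeminorm β n (fun x => v x i)).toReal) *
                  ∏ i ∈ Finset.Ioi j,
                    (FracJacobian.fracSeminorm β n (fun x => u x i)).toReal) := by
  open FracJacobian in
  obtain ⟨C, hC, hbound⟩ := exists_smoothJacobianIntegral_bound hn hβ hα hαβ
  have hn1 : (1 : ℝ) ≤ n := by exact_mod_cast hn
  have hβ0 : 0 ≤ β := (div_nonneg (by linarith) (by linarith)).trans hβ.1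
  refine ⟨C, hC, fun φ hφ => ?_⟩
  set H := nnHolderNorm α φ
  have hbound' := hbound φ H hφ.holderWith
  have stab : ∀ {ι : Type} {l : Filter ι} {w w' : ι → Euc n → Euc n} {u u' : Euc n → Euc n},
      SmoothTendsto β l w u → SmoothTendsto β l w' u' →
      ∀ᶠ k in l, |smoothJacobianIntegral (w k) φ - smoothJacobianIntegral (w' k) φ|
        ≤ C * H * jacobianDist β (w k) (w' k) := by
    intro ι l w w' u u' h h'
    filter_upwards [h.eventually_lt_top hn, h'.eventually_lt_top hn] with k hk hk'
    exact (hbound' _ (h.contDiff k) (h.compact k) hk).2 _ (h'.contDiff k) (h'.compact k) hk'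
  -- Two approximations of the same map: each summand of `jacobianDist` contains the seminorm of a
  -- difference, and that tends to zero. This gives both the Cauchy property and the independence of
  -- the approximating sequence.
  have small : ∀ {ι : Type} {l : Filter ι} {w w' : ι → Euc n → Euc n} {u : Euc n → Euc n},
      SmoothTendsto β l w u → SmoothTendsto β l w' u →
      Tendsto (fun k => |smoothJacobianIntegral (w k) φ - smoothJacobianIntegral (w' k) φ|) l
        (𝓝 0) := by
    intro ι l w w' u h h'
    have t := (h.tendsto_jacobianDist hn h').const_mul (C * H)
    rw [jacobianDist_self hn, mul_zero] at t
    exact tendsto_of_tendsto_of_tendsto_of_le_of_le' tendsto_const_nhds t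
      (Eventually.of_forall fun _ => abs_nonneg _) (stab h h')
  have ex : ∀ u, MemFracSobolev β n u → ∃ L, HasJacobianIntegral β u φ L := by
    intro u hu
    obtain ⟨w, hw⟩ := exists_isSmoothApprox hn hβ0 hβ.2 hu
    have hwt := hw.smoothTendsto hu
    have hc : CauchySeq fun k => smoothJacobianIntegral (w k) φ := by
      rw [cauchySeq_iff_tendsto_dist_atTop_0, ← prod_atTop_atTop_eq]
      simp_rw [Real.dist_eq]
      exact small (hwt.comp tendsto_fst) (hwt.comp tendsto_snd)
    obtain ⟨L, hL⟩ := cauchySeq_tendsto_of_complete hc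
    refine ⟨L, ⟨w, hw⟩, fun w' hw' => ?_⟩
    have t := (tendsto_zero_iff_abs_tendsto_zero _).2 (small (hw'.smoothTendsto hu) hwt)
    simpa using t.add hL
  classical
  -- The values of `J` outside `W^{β,n}` are arbitrary.
  choose! J hJ using ex
  refine ⟨J, hJ, fun u hu => ?_, fun u v hu hv => ?_⟩
  · obtain ⟨⟨w, hw⟩, hlim⟩ := hJ u hu
    have hwt := hw.smoothTendsto hu
    refine le_of_tendsto_of_tendsto (hlim w hw).abs
      ((tendsto_finsetProd _ fun i _ => hwt.tendsto_toReal hn i).const_mul (C * (H : ℝ))) ?_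
    filter_upwards [hwt.eventually_lt_top hn] with k hk
    exact (hbound' _ (hwt.contDiff k) (hwt.compact k) hk).1
  · obtain ⟨⟨w, hw⟩, hlim⟩ := hJ u hu
    obtain ⟨⟨w', hw'⟩, hlim'⟩ := hJ v hv
    have hwt := hw.smoothTendsto hu
    have hwt' := hw'.smoothTendsto hv
    exact le_of_tendsto_of_tendsto ((hlim w hw).sub (hlim' w' hw')).abs
      ((hwt.tendsto_jacobianDist hn hwt').const_mul (C * (H : ℝ))) (stab hwt hwt')
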